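/- **Lemma (Elliptic projection).** Let $d\in\{2,3\}$, let $k\ge 1$, and let $T\subset\mathbb R^d$ be a polytopal mesh cell: a bounded open set whose boundary $\partial T$ is a finite union of planar $(d-1)$-dimensional polytopal faces $F\in\mathcal F_T$ that overlap pairwise only in sets of zero surface measure, with unit outward normal $n_T$ (constant on each face), and which is star-shaped with respect to every point of some ball contained in $T$. For $l\ge1$ let $\mathbb P_d^l(T;\mathbb R^d)$ be the space of $\mathbb R^d$-valued polynomials of total degree at most $l$ on $T$, and for each face $F$ let $\mathbb P_{d-1}^k(F;\mathbb R^d)$ be the space of $\mathbb R^d$-valued polynomials of degree at most $k$ on $F$. Write $(\nabla v)_{ij}=\partial_j v_i$, $\varepsilon(v)=\frac12(\nabla v+\nabla v^{\mathsf T})$, $\nabla_{\mathrm{ss}}v=\frac12(\nabla v-\nabla v^{\mathsf T})$, $a\otimes_{\mathrm{ss}}b=\frac12(a\otimes b-b\otimes a)$, let $\Pi^0_T$ denote the mean value over $T$, and set $$\mathbb P_d^{l}(T;\mathbb R^d)^\perp=\{q\in\mathbb P_d^{l}(T;\mathbb R^d):\ \Pi_T^0 q=0,\ \Pi_T^0(\nabla_{\mathrm{ss}}q)=0\}.$$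 Let $\hat V_T^k=\mathbb P_d^k(T;\mathbb R^d)\times\prod_{F\in\mathcal F_T}\mathbb P_{d-1}^k(F;\mathbb R^d)$ and let the reduction operator $\hat I_T^k:H^1(T;\mathbb R^d)\to\hat V_T^k$ map $v$ to $\big(\Pi_T^k v,(\Pi_F^k(v_{|F}))_{F\in\mathcal F_T}\big)$, where $\Pi_T^k$ and $\Pi_F^k$ are the $L^2$-orthogonal projections onto the polynomial spaces of degree at most $k$ on $T$ and on $F$, and $v_{|F}$ is the trace of $v$. For every $\hat v_T=(v_T,(v_F)_{F\in\mathcal F_T})\in\hat V^k_T$ there is a unique $D_T(\hat v_T)\in\mathbb P_d^{k+1}(T;\mathbb R^d)$ such that, for all $q\in\mathbb P_d^{k+1}(T;\mathbb R^d)^\perp$, $$\int_T\varepsilon(D_T(\hat v_T)):\varepsilon(q)=-\int_T v_T\cdot\operatorname{div}\varepsilon(q)+\sum_{F\in\mathcal F_T}\int_F v_F\cdot\varepsilon(q)n_T,$$ and $$\Pi_T^0(D_T(\hat v_T))=\Pi_T^0(v_T),\qquad \Pi_T^0(\nabla_{\mathrm{ss}}D_T(\hat v_T))=\frac1{|T|}\sum_{F\in\mathcal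 F_T}\int_F v_F\otimes_{\mathrm{ss}}n_T.$$ For every $v\in H^1(T;\mathbb R^d)$ there is a unique $\mathcal E_T^{k+1}(v)\in\mathbb P_d^{k+1}(T;\mathbb R^d)$, the elliptic strain projection of $v$, such that $$\int_T\varepsilon(\mathcal E_T^{k+1}(v)-v):\varepsilon(q)=0\quad\text{for all } q\in\mathbb P_d^{k+1}(T;\mathbb R^d)^\perp,$$ $$\Pi_T^0(\mathcal E_T^{k+1}(v)-v)=0,\qquad \Pi_T^0\big(\nabla_{\mathrm{ss}}(\mathcal E_T^{k+1}(v)-v)\big)=0.$$ Moreover $D_T\circ\hat I_T^k=\mathcal E_T^{k+1}$ on $H^1(T;\mathbb R^d)$. -/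

import Mathlib

open MeasureTheory Set Filter Topology
open scoped ContDiff

noncomputable section

namespace HHO

/-- The Euclidean space `ℝ^d`. -/
abbrev Space (d : ℕ) := EuclideanSpace ℝ (Fin d)

/-- A (nonempty, not necessarily convex or connected) polytope of dimension `n - 1` in `ℝ^d`:
a finite union of simplices with `n` vertices. -/
def IsPolytope {d : ℕ} (n : ℕ) (S : Set (Space d)) : Prop :=
  S.Nonempty ∧ ∃ (N : ℕ) (s : Fin N → Fin n → Space d),
    (∀ j, AffineIndependent ℝ (s j)) ∧ S = ⋃ j, convexHull ℝ (range (s j))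

/-- A polytopal mesh cell `T ⊂ ℝ^d` (an open set) with its faces and unit outward normals; the cell
is star-shaped with respect to every point of some ball. -/
structure PolytopalCell (d : ℕ) where
  /-- the open cell `T` -/
  carrier : Set (Space d)
  isOpen : IsOpen carrier
  isBounded : Bornology.IsBounded carrier
  exists_ball : ∃ (x₀ : Space d) (ρ : ℝ), 0 < ρ ∧ Metric.ball x₀ ρ ⊆ carrier ∧
    ∀ y ∈ Metric.ball x₀ ρ, StarConvex ℝ y carrier
  /-- the number of faces -/
  numFaces : ℕ
  /-- the (closed) faces -/
  face : Fin numFaces → Set (Space d)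
  face_isPolytope : ∀ i, IsPolytope d (face i)
  iUnion_face : ⋃ i, face i = frontier carrier
  face_inter : ∀ i j, i ≠ j →
    (Measure.euclideanHausdorffMeasure (d - 1) : Measure (Space d)) (face i ∩ face j) = 0
  /-- the unit outward normal on each face -/
  normal : Fin numFaces → Space d
  norm_normal : ∀ i, ‖normal i‖ = 1
  /-- each face lies in a hyperplane orthogonal to its normal -/
  face_planar : ∀ i, ∀ x ∈ face i, ∀ y ∈ face i, inner ℝ (normal i) (y - x) = 0
  /-- the normal points out of the cell: near a point that lies on one face only, the cell is the
  half-space on the side opposite to the normal -/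
  normal_outward : ∀ i, ∀ x ∈ face i, (∀ j, j ≠ i → x ∉ face j) →
    ∃ r > 0, ∀ y ∈ Metric.ball x r, y ∈ carrier ↔ inner ℝ (normal i) (y - x) < 0

/-- The surface measure on the boundary of the cell. -/
def PolytopalCell.surface {d : ℕ} (T : PolytopalCell d) : Measure (Space d) :=
  (Measure.euclideanHausdorffMeasure (d - 1)).restrict (frontier T.carrier)

/-- The surface measure on a subset `F` of a hyperplane, as a measure on the type `F`. -/
def faceMeasure {d : ℕ} (F : Set (Space d)) : Measure F :=
  (Measure.euclideanHausdorffMeasure (d - 1) : Measure (Space d)).comap Subtype.val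

/-! ### Matrices -/

/-- Symmetric part `(M + Mᵀ) / 2`. -/
def symPart {d : ℕ} (M : Matrix (Fin d) (Fin d) ℝ) : Matrix (Fin d) (Fin d) ℝ :=
  (2⁻¹ : ℝ) • (M + M.transpose)

/-- Skew-symmetric part `(M - Mᵀ) / 2`. -/
def skewPart {d : ℕ} (M : Matrix (Fin d) (Fin d) ℝ) : Matrix (Fin d) (Fin d) ℝ :=
  (2⁻¹ : ℝ) • (M - M.transpose)

/-- Frobenius inner product `A : B`. -/
def frob {d : ℕ} (A B : Matrix (Fin d) (Fin d) ℝ) : ℝ := ∑ i, ∑ j, A i j * B i j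

/-- `a ⊗ₛₛ b = (a ⊗ b - b ⊗ a) / 2`. -/
def skewTensor {d : ℕ} (a b : Space d) : Matrix (Fin d) (Fin d) ℝ :=
  skewPart (Matrix.of fun i j => a i * b j)

/-- The action `M a` of a matrix on a vector. -/
def matVec {d : ℕ} (M : Matrix (Fin d) (Fin d) ℝ) (a : Space d) : Space d :=
  WithLp.toLp 2 (M.mulVec fun j => a j)

/-- Mean value over the set `S` of a vector field (the `L²`-projection onto constants). -/
def meanVec {d : ℕ} (S : Set (Space d)) (v : Space d → Space d) : Space d := ⨍ x in S, v x

/-- Mean value over the set `S` of a matrix field, entry by entry. -/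
def meanMat {d : ℕ} (S : Set (Space d)) (M : Space d → Matrix (Fin d) (Fin d) ℝ) :
    Matrix (Fin d) (Fin d) ℝ :=
  Matrix.of fun i j => ⨍ x in S, M x i j

/-! ### Vector-valued polynomials -/

/-- The space of `ℝ^d`-valued `d`-variate polynomials of total degree at most `l`. -/
def vecPoly (d l : ℕ) : Submodule ℝ (Fin d → MvPolynomial (Fin d) ℝ) :=
  Submodule.pi univ fun _ => MvPolynomial.restrictTotalDegree (Fin d) ℝ l

/-- Value of a vector-valued polynomial at a point. -/
def evalVec {d : ℕ} (p : Fin d → MvPolynomial (Fin d) ℝ) (x : Space d) : Space d :=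
  WithLp.toLp 2 fun i => MvPolynomial.eval (fun j => x j) (p i)

/-- Gradient of a vector-valued polynomial: `(∇p)_{ij} = ∂_j p_i`. -/
def polyGrad {d : ℕ} (p : Fin d → MvPolynomial (Fin d) ℝ) (x : Space d) :
    Matrix (Fin d) (Fin d) ℝ :=
  Matrix.of fun i j => MvPolynomial.eval (fun m => x m) (MvPolynomial.pderiv j (p i))

/-- The strain `ε(p) = (∇p + ∇pᵀ) / 2` of a vector-valued polynomial. -/
def polyStrain {d : ℕ} (p : Fin d → MvPolynomial (Fin d) ℝ) (x : Space d) :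
    Matrix (Fin d) (Fin d) ℝ :=
  symPart (polyGrad p x)

/-- The row-wise divergence of the strain of a vector-valued polynomial:
`(div ε(p))_i = ∑_j ∂_j (∂_j p_i + ∂_i p_j) / 2`. -/
def polyDivStrain {d : ℕ} (p : Fin d → MvPolynomial (Fin d) ℝ) :
    Fin d → MvPolynomial (Fin d) ℝ :=
  fun i => ∑ j, MvPolynomial.pderiv j
    (MvPolynomial.C (2⁻¹ : ℝ) * (MvPolynomial.pderiv j (p i) + MvPolynomial.pderiv i (p j)))

/-- Restriction of vector-valued polynomials to a set `F`. -/
def restrictPoly {d : ℕ} (F : Set (Space d)) :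
    (Fin d → MvPolynomial (Fin d) ℝ) →ₗ[ℝ] (F → Space d) where
  toFun p := fun x => evalVec p x
  map_add' p q := by
    funext x
    ext i
    simp [evalVec]
  map_smul' c p := by
    funext x
    ext i
    simp [evalVec, MvPolynomial.smul_eval]

/-- The space of `ℝ^d`-valued functions on the planar set `F` that are polynomials of degree at most
`k` on it, that is, restrictions to `F` of polynomials of degree at most `k`. -/
def facePoly {d : ℕ} (F : Set (Space d)) (k : ℕ) : Submodule ℝ (F → Space d) :=
  (vecPoly d k).map (restrictPoly F)

/-- The subspace of the polynomials `q` of degree at most `l` whose mean value and mean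
skew-symmetric gradient over `T` vanish: the complement of the rigid-body motions. -/
def perpPoly {d : ℕ} (T : PolytopalCell d) (l : ℕ) : Set (Fin d → MvPolynomial (Fin d) ℝ) :=
  {q | q ∈ vecPoly d l ∧ meanVec T.carrier (evalVec q) = 0 ∧
    meanMat T.carrier (fun x => skewPart (polyGrad q x)) = 0}

/-! ### The Sobolev space `H¹(T; ℝ^d)` and the trace -/

/-- An element of `H¹(T; ℝ^d)`: a square-integrable field with a square-integrable weak gradient,
`grad x i j` standing for `∂_j v_i (x)`. -/
structure H1 {d : ℕ} (T : PolytopalCell d) where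
  /-- the field -/
  toFun : Space d → Space d
  /-- its weak gradient -/
  grad : Space d → Matrix (Fin d) (Fin d) ℝ
  memLp : MemLp toFun 2 (volume.restrict T.carrier)
  memLp_grad : ∀ i j, MemLp (fun x => grad x i j) 2 (volume.restrict T.carrier)
  weak_grad : ∀ φ : Space d → ℝ, ContDiff ℝ ∞ φ → HasCompactSupport φ →
    tsupport φ ⊆ T.carrier → ∀ i j,
      ∫ x in T.carrier, toFun x i * fderiv ℝ φ x (EuclideanSpace.single j 1) =
        - ∫ x in T.carrier, grad x i j * φ x

/-- `g` is the trace of `v` on the boundary of `T`: there are smooth fields that converge to `v` in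
`H¹(T)` and whose restrictions to the boundary converge to `g` in `L²(∂T)`. -/
def IsTrace {d : ℕ} (T : PolytopalCell d) (v : H1 T) (g : Space d → Space d) : Prop :=
  MemLp g 2 T.surface ∧ ∃ u : ℕ → Space d → Space d,
    (∀ n, ContDiff ℝ ∞ (u n)) ∧
    Tendsto (fun n => eLpNorm (fun x => u n x - v.toFun x) 2 (volume.restrict T.carrier))
      atTop (𝓝 0) ∧
    (∀ i j, Tendsto (fun n => eLpNorm
        (fun x => fderiv ℝ (u n) x (EuclideanSpace.single j 1) i - v.grad x i j) 2
        (volume.restrict T.carrier)) atTop (𝓝 0)) ∧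
    Tendsto (fun n => eLpNorm (fun x => u n x - g x) 2 T.surface) atTop (𝓝 0)

/-- The trace of `v` on the boundary of `T` (unique almost everywhere for the surface measure). -/
def trace {d : ℕ} (T : PolytopalCell d) (v : H1 T) : Space d → Space d :=
  Classical.epsilon (IsTrace T v)

/-! ### Local unknowns and reduction operator -/

/-- The local space of cell and face unknowns of degree `k`. -/
abbrev LocalSpace {d : ℕ} (T : PolytopalCell d) (k : ℕ) :=
  vecPoly d k × (∀ i : Fin T.numFaces, facePoly (T.face i) k)

/-- The `L²(T)`-orthogonal projection of a field onto the polynomials of degree at most `k`. -/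
def cellProj {d : ℕ} (T : PolytopalCell d) (k : ℕ) (v : Space d → Space d) : vecPoly d k :=
  Classical.epsilon fun p : vecPoly d k => ∀ q : vecPoly d k,
    ∫ x in T.carrier, inner ℝ (evalVec p.1 x - v x) (evalVec q.1 x) = 0

/-- The `L²(F)`-orthogonal projection of a field onto the polynomials of degree at most `k`
on the planar set `F`. -/
def faceProj {d : ℕ} (F : Set (Space d)) (k : ℕ) (g : Space d → Space d) : facePoly F k :=
  Classical.epsilon fun w : facePoly F k => ∀ q : facePoly F k,
    ∫ x : F, inner ℝ (w.1 x - g x) (q.1 x) ∂(faceMeasure F) = 0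

/-- The local reduction operator `H¹(T; ℝ^d) → LocalSpace T k`: project the field in the cell and
its trace on every face. -/
def reduction {d : ℕ} (T : PolytopalCell d) (k : ℕ) (v : H1 T) : LocalSpace T k :=
  (cellProj T k v.toFun, fun i => faceProj (T.face i) k (trace T v))

/-! ### Displacement reconstruction and elliptic strain projection -/

/-- The conditions that define the displacement `p`, a polynomial of degree at most `k + 1`,
reconstructed from the local unknowns `w`. -/
def IsDispRec {d : ℕ} (T : PolytopalCell d) (k : ℕ) (w : LocalSpace T k)
    (p : vecPoly d (k + 1)) : Prop :=
  (∀ q ∈ perpPoly T (k + 1),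
    ∫ x in T.carrier, frob (polyStrain p.1 x) (polyStrain q x) =
      - (∫ x in T.carrier, inner ℝ (evalVec w.1.1 x) (evalVec (polyDivStrain q) x)) +
        ∑ i, ∫ x : T.face i, inner ℝ ((w.2 i).1 x) (matVec (polyStrain q x) (T.normal i))
          ∂(faceMeasure (T.face i))) ∧
  meanVec T.carrier (evalVec p.1) = meanVec T.carrier (evalVec w.1.1) ∧
  meanMat T.carrier (fun x => skewPart (polyGrad p.1 x)) =
    Matrix.of fun a b => (volume.real T.carrier)⁻¹ *
      ∑ i, ∫ x : T.face i, skewTensor ((w.2 i).1 x) (T.normal i) a b ∂(faceMeasure (T.face i))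

/-- The displacement reconstruction operator. -/
def dispRec {d : ℕ} (T : PolytopalCell d) (k : ℕ) (w : LocalSpace T k) : vecPoly d (k + 1) :=
  Classical.epsilon (IsDispRec T k w)

/-- The conditions that define the elliptic strain projection `p` of `v`. -/
def IsEllipticProj {d : ℕ} (T : PolytopalCell d) (k : ℕ) (v : H1 T)
    (p : vecPoly d (k + 1)) : Prop :=
  (∀ q ∈ perpPoly T (k + 1),
    ∫ x in T.carrier, frob (polyStrain p.1 x - symPart (v.grad x)) (polyStrain q x) = 0) ∧
  meanVec T.carrier (fun x => evalVec p.1 x - v.toFun x) = 0 ∧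
  meanMat T.carrier (fun x => skewPart (polyGrad p.1 x - v.grad x)) = 0

/-- The elliptic strain projection onto the polynomials of degree at most `k + 1`. -/
def ellipticProj {d : ℕ} (T : PolytopalCell d) (k : ℕ) (v : H1 T) : vecPoly d (k + 1) :=
  Classical.epsilon (IsEllipticProj T k v)

end HHO

end

noncomputable section

namespace HHO

/-! ### Cones over planar sets -/

/-! Both constructions are pure traction problems for the form `∫ ε(p) : ε(q)` on polynomials of
degree `k + 1`, with the mean and the mean skew gradient prescribed. The form is symmetric and
positive semidefinite. Its kernel consists of the polynomials with zero strain; these are affine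
with skew gradient, because their second derivatives vanish. A functional that vanishes on this
kernel is represented by some polynomial on the whole space, and adding a rigid motion adjusts the
two moments without changing the energy. For uniqueness, the difference of two solutions is an
admissible test field, so it has zero energy, hence zero strain, and its zero moments kill it. This
is `existsUnique_traction`; it applies to both problems because both right-hand sides depend on `q`
only through `ε(q)`.

For the commutation, uniqueness reduces the claim to `isDispRec_reduction`: the elliptic projection
of `v` solves the reconstruction problem whose data are the reduction of `v`. The projections in the
data disappear, since they are tested only against `div ε(q)`, `ε(q) n` and constants, all of degree
at most `k`. What remains is Green's formula for an `H¹` field and its trace.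

The analytic work is therefore to construct the trace and prove that formula, and both rest on
star-shapedness. Seen from a point `y` of the kernel ball, the cell is, up to a null set, an almost
disjoint union of cones over its faces. Integration along rays yields the divergence theorem for the
fields `f(x) (x - y)` (`integral_radial_divergence`). Subtracting it for two nearby apices gives the
usual divergence theorem (`integral_fderiv_eq`); taking `f = h ^ 2` gives the trace inequality,
because the weight `n · (x - y)` is bounded below on the faces that matter. Smooth fields are dense
in `H¹`: the mean of `v` over a ball of radius `(1 - l) ρ` around `l x + (1 - l) c` uses only values
of `v` inside the cell (`exists_smooth_tendsto`). -/

theorem volume_eq_lintegral_slices {d : ℕ} (y : Space d) {n : Space d} (hn : ‖n‖ = 1)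
    {A : Set (Space d)} (hA : MeasurableSet A) :
    volume A = ∫⁻ s : ℝ, (Measure.euclideanHausdorffMeasure (d - 1) : Measure (Space d))
      (A ∩ {x | inner ℝ n (x - y) = s}) := by
  have hn0 : n ≠ 0 := by rintro rfl; simp at hn
  have h := EuclideanGeometry.euclideanHausdorffMeasure_eq_lintegral y hn0 hA
  rw [finrank_euclideanSpace_fin, EuclideanSpace.euclideanHausdorffMeasure_eq_volume] at h
  rw [h]
  have : ‖n‖ₑ = 1 := by simp [← ofReal_norm, hn]
  rw [this, one_mul]
  refine lintegral_congr fun s => ?_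
  congr 2
  ext x
  simp only [SetLike.mem_coe, AffineSubspace.mem_mk', Submodule.mem_orthogonal_singleton_iff_inner_right,
    mem_ofPred_eq, vsub_eq_sub, vadd_eq_add]
  have : x - (s • n + y) = (x - y) - s • n := by abel
  rw [this, inner_sub_right, inner_smul_right, real_inner_self_eq_norm_sq, hn]
  constructor <;> intro h <;> linarith

/-- The hyperplane through `y` is an isometric copy of `(ℝ ∙ n)ᗮ`, where this Hausdorff measure is
Lebesgue measure and bounded sets have finite measure. -/
theorem euclideanHausdorffMeasure_lt_top {d : ℕ} (y : Space d) {n : Space d} (hn : ‖n‖ = 1)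
    {B : Set (Space d)} (hB : ∀ x ∈ B, inner ℝ n (x - y) = 0) (hb : Bornology.IsBounded B) :
    (Measure.euclideanHausdorffMeasure (d - 1) : Measure (Space d)) B < ⊤ := by
  have hn0 : n ≠ 0 := by rintro rfl; simp at hn
  have hr : Module.finrank ℝ (ℝ ∙ n)ᗮ = d - 1 := by
    have := (ℝ ∙ n).finrank_add_finrank_orthogonal
    rw [finrank_span_singleton hn0, finrank_euclideanSpace_fin] at this
    omega
  let f : (ℝ ∙ n)ᗮ → Space d := fun z => (z : Space d) + y
  have hf : Isometry f := by
    refine Isometry.of_dist_eq fun a b => ?_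
    simp [f]
    rfl
  have hBr : f '' (f ⁻¹' B) = B := by
    rw [image_preimage_eq_inter_range, inter_eq_left]
    intro x hx
    exact ⟨⟨x - y, Submodule.mem_orthogonal_singleton_iff_inner_right.2 (hB x hx)⟩, by simp [f]⟩
  rw [← hBr, hf.euclideanHausdorffMeasure_image, ← hr,
    InnerProductSpace.euclideanHausdorffMeasure_eq_volume]
  exact (hf.antilipschitz.isBounded_preimage hb).measure_lt_top

/-- The open cone with apex `y` over the set `B`, without its apex. -/
def openCone {d : ℕ} (y : Space d) (B : Set (Space d)) : Set (Space d) :=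
  {x | ∃ t ∈ Ioo (0 : ℝ) 1, ∃ b ∈ B, x = y + t • (b - y)}

theorem openCone_inter_plane {d : ℕ} (y : Space d) {n : Space d} {h : ℝ} (hh : 0 < h)
    {B : Set (Space d)} (hB : ∀ x ∈ B, inner ℝ n (x - y) = h) {t : ℝ} (ht : t ∈ Ioo (0 : ℝ) 1) :
    openCone y B ∩ {x | inner ℝ n (x - y) = h * t} = AffineMap.homothety y t '' B := by
  ext x
  constructor
  · rintro ⟨⟨t', ht', b, hb, rfl⟩, hx⟩
    simp only [mem_ofPred_eq, add_sub_cancel_left, inner_smul_right, hB b hb] at hx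
    have : t' = t := by
      have := mul_left_cancel₀ hh.ne' ((mul_comm h t').trans hx)
      exact this
    subst this
    exact ⟨b, hb, by simp [AffineMap.homothety_apply, add_comm]⟩
  · rintro ⟨b, hb, rfl⟩
    refine ⟨⟨t, ht, b, hb, by simp [AffineMap.homothety_apply, add_comm]⟩, ?_⟩
    simp [AffineMap.homothety_apply, inner_smul_right, hB b hb, mul_comm]

/-- The cone is the slab of heights in `(0, h)` intersected with the preimage of `B` under central
projection from the apex, which is a measurable map. -/
theorem measurableSet_openCone {d : ℕ} (y : Space d) {n : Space d} {h : ℝ} (hh : 0 < h)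
    {B : Set (Space d)} (hB : ∀ x ∈ B, inner ℝ n (x - y) = h) (hm : MeasurableSet B) :
    MeasurableSet (openCone y B) := by
  have : openCone y B = {x | inner ℝ n (x - y) ∈ Ioo 0 h} ∩
      (fun x => y + (h / inner ℝ n (x - y)) • (x - y)) ⁻¹' B := by
    ext x
    constructor
    · rintro ⟨t, ht, b, hb, rfl⟩
      have h0 : t ≠ 0 := ht.1.ne'
      refine ⟨?_, ?_⟩
      · simp only [mem_ofPred_eq, add_sub_cancel_left, inner_smul_right, hB b hb]
        exact ⟨mul_pos ht.1 hh, by nlinarith [ht.2]⟩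
      · simp only [mem_preimage, add_sub_cancel_left, inner_smul_right, hB b hb, smul_smul]
        rw [show h / (t * h) * t = 1 by field_simp]
        simpa using hb
    · rintro ⟨hx, hxB⟩
      simp only [mem_ofPred_eq, mem_preimage] at hx hxB
      refine ⟨inner ℝ n (x - y) / h, ⟨div_pos hx.1 hh, (div_lt_one hh).2 hx.2⟩, _, hxB, ?_⟩
      have h1 := hx.1.ne'
      rw [add_sub_cancel_left, smul_smul, show inner ℝ n (x - y) / h * (h / inner ℝ n (x - y)) = 1 by
        field_simp]
      simp
  rw [this]
  refine MeasurableSet.inter ?_ ?_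
  · exact measurableSet_Ioo.preimage (f := fun x => inner ℝ n (x - y)) (by fun_prop)
  · refine hm.preimage ?_
    fun_prop

theorem lintegral_eq_lintegral_comp_mul_left {h : ℝ} (hh : 0 < h) (g : ℝ → ENNReal) :
    ∫⁻ s, g s = ∫⁻ t, ENNReal.ofReal h * g (h * t) := by
  have he : MeasurableEmbedding (h * ·) := (Homeomorph.mulLeft₀ h hh.ne').measurableEmbedding
  conv_lhs => rw [← Real.smul_map_volume_mul_left hh.ne']
  rw [lintegral_smul_measure, he.lintegral_map, lintegral_const_mul' _ _ ENNReal.ofReal_ne_top,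
    abs_of_pos hh, smul_eq_mul]

/-- The weight of the radial variable in cone coordinates. -/
def radialMeasure (d : ℕ) (h : ℝ) : Measure ℝ :=
  (volume.restrict (Ioo 0 1)).withDensity fun t => ENNReal.ofReal (h * t ^ (d - 1))

instance (d : ℕ) (h : ℝ) : SFinite (radialMeasure d h) := by
  unfold radialMeasure; infer_instance

/-- Fubini over the height `s = h t`: the slice there is the image of `B` under the homothety of
ratio `t`, which scales surface measure by `t ^ (d - 1)`, and `ds = h dt`. -/
theorem volume_restrict_openCone {d : ℕ} (y : Space d) {n : Space d} (hn : ‖n‖ = 1) {h : ℝ}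
    (hh : 0 < h) {B : Set (Space d)} (hB : ∀ x ∈ B, inner ℝ n (x - y) = h) (hm : MeasurableSet B)
    (hb : Bornology.IsBounded B) :
    volume.restrict (openCone y B) = ((radialMeasure d h).prod
      ((Measure.euclideanHausdorffMeasure (d - 1)).restrict B)).map
        fun p : ℝ × Space d => y + p.1 • (p.2 - y) := by
  have hfin : IsFiniteMeasure
      ((Measure.euclideanHausdorffMeasure (d - 1) : Measure (Space d)).restrict B) := by
    constructor
    rw [Measure.restrict_apply_univ]
    refine euclideanHausdorffMeasure_lt_top (y + h • n) hn (fun x hx => ?_) hb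
    rw [sub_add_eq_sub_sub, inner_sub_right, hB x hx, inner_smul_right,
      real_inner_self_eq_norm_sq, hn]
    simp
  have hmeas : Measurable fun p : ℝ × Space d => y + p.1 • (p.2 - y) := by fun_prop
  ext A hA
  have hcone := measurableSet_openCone y hh hB hm
  rw [Measure.map_apply hmeas hA, Measure.restrict_apply hA, Measure.prod_apply (hmeas hA),
    radialMeasure, lintegral_withDensity_eq_lintegral_mul _ (by fun_prop)
      (measurable_measure_prodMk_left (hmeas hA)),
    volume_eq_lintegral_slices y hn (hA.inter hcone), ← lintegral_indicator measurableSet_Ioo]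
  have key : ∀ t : ℝ, (Measure.euclideanHausdorffMeasure (d - 1) : Measure (Space d))
      ((A ∩ openCone y B) ∩ {x | inner ℝ n (x - y) = h * t}) = (Ioo (0 : ℝ) 1).indicator
        (fun t => ENNReal.ofReal (t ^ (d - 1)) *
          ((Measure.euclideanHausdorffMeasure (d - 1) : Measure (Space d)).restrict B)
            (Prod.mk t ⁻¹' ((fun p : ℝ × Space d => y + p.1 • (p.2 - y)) ⁻¹' A))) t := by
    intro t
    by_cases ht : t ∈ Ioo (0 : ℝ) 1
    · rw [indicator_of_mem ht, inter_assoc, openCone_inter_plane y hh hB ht,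
        Measure.restrict_apply (measurable_prodMk_left (hmeas hA))]
      have : A ∩ AffineMap.homothety y t '' B = AffineMap.homothety y t ''
          (Prod.mk t ⁻¹' ((fun p : ℝ × Space d => y + p.1 • (p.2 - y)) ⁻¹' A) ∩ B) := by
        rw [inter_comm, ← image_inter_preimage, inter_comm]
        congr 2
        ext x
        simp [AffineMap.homothety_apply, add_comm]
      rw [this, MeasureTheory.euclideanHausdorffMeasure_homothety_image _ _ ht.1.ne']
      rw [ENNReal.smul_def, smul_eq_mul]
      congr 1
      rw [ENNReal.ofReal_pow ht.1.le, ENNReal.coe_pow, ← enorm_eq_nnnorm, Real.enorm_of_nonneg ht.1.le]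
    · rw [indicator_of_notMem ht]
      convert! measure_empty
      · ext x
        simp only [mem_inter_iff, mem_ofPred_eq, mem_empty_iff_false, iff_false]
        rintro ⟨⟨-, t', ht', b, hb, rfl⟩, hx⟩
        simp only [add_sub_cancel_left, inner_smul_right, hB b hb] at hx
        rw [mul_comm] at hx
        exact ht (mul_left_cancel₀ hh.ne' hx ▸ ht')
      · infer_instance
  rw [lintegral_eq_lintegral_comp_mul_left hh]
  refine lintegral_congr fun t => ?_
  rw [key]
  by_cases ht : t ∈ Ioo (0 : ℝ) 1
  · simp only [indicator_of_mem ht, Pi.mul_apply]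
    rw [ENNReal.ofReal_mul hh.le, mul_assoc]
  · simp [indicator_of_notMem ht]

/-- The sign of `h` is left free because nothing places a negligible face on a definite side of the
apex. A negative height is handled by reversing `n`; at height zero the cone lies in a hyperplane.
-/
theorem volume_openCone_eq_zero {d : ℕ} (y : Space d) {n : Space d} (hn : ‖n‖ = 1) {h : ℝ}
    {B : Set (Space d)} (hB : ∀ x ∈ B, inner ℝ n (x - y) = h) (hm : MeasurableSet B)
    (hb : Bornology.IsBounded B)
    (h0 : (Measure.euclideanHausdorffMeasure (d - 1) : Measure (Space d)) B = 0) :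
    volume (openCone y B) = 0 := by
  have pos : ∀ {n : Space d}, ‖n‖ = 1 → ∀ {h : ℝ}, 0 < h → (∀ x ∈ B, inner ℝ n (x - y) = h) →
      volume (openCone y B) = 0 := by
    intro n hn h hh hB
    have := volume_restrict_openCone y hn hh hB hm hb
    rw [Measure.restrict_eq_zero.2 h0, Measure.prod_zero, Measure.map_zero] at this
    exact Measure.restrict_eq_zero.1 this
  rcases lt_trichotomy h 0 with hh | rfl | hh
  · exact pos (n := -n) (by simpa using hn) (neg_pos.2 hh)
      (fun x hx => by rw [inner_neg_left, hB x hx])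
  · refine measure_mono_null (t := {x | inner ℝ n (x - y) = 0}) ?_ ?_
    · rintro x ⟨t, -, b, hb, rfl⟩
      simp [inner_smul_right, hB b hb]
    · have hmeas : MeasurableSet {x : Space d | inner ℝ n (x - y) = 0} :=
        (isClosed_eq (by fun_prop) continuous_const).measurableSet
      rw [volume_eq_lintegral_slices y hn hmeas]
      refine (lintegral_congr_ae (g := fun _ => 0) ?_).trans lintegral_zero
      filter_upwards [compl_mem_ae_iff.2 (measure_singleton (0 : ℝ))] with s hs
      convert! measure_empty
      · ext x
        simp only [mem_inter_iff, mem_ofPred_eq, mem_empty_iff_false, iff_false, not_and]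
        intro h1 h2
        exact hs (h2.symm.trans h1)
      · infer_instance
  · exact pos hn hh hB

/-- The integrand is the derivative of `t ^ d * f (y + t • (b - y))`, which vanishes at `t = 0` as
`d > 0`. -/
theorem integral_radial {d : ℕ} (hd : 0 < d) {f : Space d → ℝ} (hf : ContDiff ℝ 1 f)
    (y b : Space d) :
    ∫ t in Ioo (0 : ℝ) 1, t ^ (d - 1) * (d * f (y + t • (b - y)) +
      fderiv ℝ f (y + t • (b - y)) (t • (b - y))) = f b := by
  have hc : Continuous fun x => fderiv ℝ f x := hf.continuous_fderiv (by norm_num)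
  have hcf : Continuous f := hf.continuous
  have hcont : Continuous fun t : ℝ => t ^ (d - 1) * (d * f (y + t • (b - y)) +
      fderiv ℝ f (y + t • (b - y)) (t • (b - y))) := by
    have : Continuous fun t : ℝ => fderiv ℝ f (y + t • (b - y)) := hc.comp (by fun_prop)
    fun_prop
  rw [← integral_Ioc_eq_integral_Ioo, ← intervalIntegral.integral_of_le zero_le_one,
    intervalIntegral.integral_eq_sub_of_hasDerivAt (f := fun t => t ^ d * f (y + t • (b - y)))]
  · simp [hd.ne']
  · intro t _
    have h1 : HasDerivAt (fun t : ℝ => y + t • (b - y)) (b - y) t := by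
      simpa using ((hasDerivAt_id t).smul_const (b - y)).const_add y
    have h2 : HasDerivAt (fun t : ℝ => f (y + t • (b - y))) (fderiv ℝ f (y + t • (b - y)) (b - y)) t :=
      (hf.differentiable (by norm_num) _).hasFDerivAt.comp_hasDerivAt t h1
    convert! (hasDerivAt_pow d t).mul h2 using 1
    rw [map_smul, smul_eq_mul]
    obtain ⟨m, rfl⟩ : ∃ m, d = m + 1 := ⟨d - 1, by omega⟩
    simp only [Nat.add_sub_cancel]
    ring
  · exact hcont.intervalIntegrable _ _

theorem isBounded_openCone {d : ℕ} (y : Space d) {B : Set (Space d)} (hb : Bornology.IsBounded B) :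
    Bornology.IsBounded (openCone y B) := by
  obtain ⟨R, hR⟩ := hb.subset_closedBall y
  refine (Metric.isBounded_closedBall (x := y) (r := R)).subset ?_
  rintro x ⟨t, ht, b, hb, rfl⟩
  have := hR hb
  rw [mem_closedBall_iff_norm] at this ⊢
  rw [add_sub_cancel_left, norm_smul, Real.norm_of_nonneg ht.1.le]
  nlinarith [norm_nonneg (b - y), ht.2]

theorem _root_.Continuous.integrableOn_of_isBounded {d : ℕ} {F : Type*} [NormedAddCommGroup F]
    {f : Space d → F} (hf : Continuous f) {S : Set (Space d)} (hS : Bornology.IsBounded S)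
    {μ : Measure (Space d)} [IsFiniteMeasureOnCompacts μ] : IntegrableOn f S μ :=
  (hf.continuousOn.integrableOn_compact hS.isCompact_closure).mono_set subset_closure

/-- Divergence theorem for the field `f(x) (x - y)`: it is tangent to the lateral side of the cone,
so only the base contributes. In cone coordinates each ray integral is given by `integral_radial`.
-/
theorem integral_openCone {d : ℕ} (hd : 0 < d) (y : Space d) {n : Space d} (hn : ‖n‖ = 1) {h : ℝ}
    (hh : 0 < h) {B : Set (Space d)} (hB : ∀ x ∈ B, inner ℝ n (x - y) = h) (hm : MeasurableSet B)
    (hb : Bornology.IsBounded B) {f : Space d → ℝ} (hf : ContDiff ℝ 1 f) :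
    ∫ x in openCone y B, (d * f x + fderiv ℝ f x (x - y)) =
      ∫ x in B, inner ℝ n (x - y) * f x ∂(Measure.euclideanHausdorffMeasure (d - 1)) := by
  have hc : Continuous fun x => fderiv ℝ f x := hf.continuous_fderiv (by norm_num)
  have hcf : Continuous f := hf.continuous
  have hG : Continuous fun x => (d * f x + fderiv ℝ f x (x - y)) := by fun_prop
  have hint : IntegrableOn (fun x => (d * f x + fderiv ℝ f x (x - y))) (openCone y B) volume :=
    hG.integrableOn_of_isBounded (isBounded_openCone y hb)
  have hmeas : Measurable fun p : ℝ × Space d => y + p.1 • (p.2 - y) := by fun_prop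
  rw [IntegrableOn, volume_restrict_openCone y hn hh hB hm hb,
    integrable_map_measure hG.aestronglyMeasurable hmeas.aemeasurable] at hint
  have hfin : IsFiniteMeasure
      ((Measure.euclideanHausdorffMeasure (d - 1) : Measure (Space d)).restrict B) := by
    constructor
    rw [Measure.restrict_apply_univ]
    refine euclideanHausdorffMeasure_lt_top (y + h • n) hn (fun x hx => ?_) hb
    rw [sub_add_eq_sub_sub, inner_sub_right, hB x hx, inner_smul_right,
      real_inner_self_eq_norm_sq, hn]
    simp
  rw [volume_restrict_openCone y hn hh hB hm hb, integral_map hmeas.aemeasurable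
    hG.aestronglyMeasurable]
  refine (integral_prod_symm _ hint).trans ?_
  refine setIntegral_congr_fun hm fun b hb => ?_
  simp only [hB b hb]
  rw [radialMeasure, integral_withDensity_eq_integral_toReal_smul (by fun_prop) (by simp),
    ← integral_radial hd hf y b, ← integral_const_mul]
  refine setIntegral_congr_fun measurableSet_Ioo fun t ht => ?_
  simp only [smul_eq_mul]
  rw [ENNReal.toReal_ofReal (mul_nonneg hh.le (pow_nonneg ht.1.le _)), mul_assoc]
  simp

/-! ### Geometry of a polytopal cell -/

namespace PolytopalCell

variable {d : ℕ} (T : PolytopalCell d)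

/-- The centre of a ball with respect to all of whose points the cell is star-shaped. -/
def center : Space d := T.exists_ball.choose

/-- The radius of a ball with respect to all of whose points the cell is star-shaped. -/
def radius : ℝ := T.exists_ball.choose_spec.choose

theorem radius_pos : 0 < T.radius := T.exists_ball.choose_spec.choose_spec.1

/-- The ball with respect to all of whose points the cell is star-shaped. -/
def kernelBall : Set (Space d) := Metric.ball T.center T.radius

theorem kernelBall_subset : T.kernelBall ⊆ T.carrier :=
  T.exists_ball.choose_spec.choose_spec.2.1

theorem starConvex {y : Space d} (hy : y ∈ T.kernelBall) : StarConvex ℝ y T.carrier :=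
  T.exists_ball.choose_spec.choose_spec.2.2 y hy

theorem center_mem : T.center ∈ T.kernelBall := Metric.mem_ball_self T.radius_pos

/-- Star-shapedness reaches only points of the open cell. A boundary point `b` is replaced by a
nearby `b'` in the cell, and the apex is moved within the kernel ball to compensate. -/
theorem segment_mem {y b : Space d} (hy : y ∈ T.kernelBall) (hb : b ∈ closure T.carrier) {t : ℝ}
    (ht : t ∈ Ico (0 : ℝ) 1) : y + t • (b - y) ∈ T.carrier := by
  rcases ht.1.eq_or_lt with rfl | ht0
  · simpa using T.kernelBall_subset hy
  obtain ⟨δ, hδ, hball⟩ := Metric.isOpen_iff.1 (Metric.isOpen_ball : IsOpen T.kernelBall) y hy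
  have h1 : 0 < 1 - t := by linarith [ht.2]
  obtain ⟨b', hb', hbb⟩ := Metric.mem_closure_iff.1 hb (δ * (1 - t) / t) (by positivity)
  -- The new apex `y'` satisfies `(1 - t) y' + t b' = y + t (b - y)`.
  have hy' : y + (t / (1 - t)) • (b - b') ∈ T.kernelBall := by
    apply hball
    rw [mem_ball_iff_norm, add_sub_cancel_left, norm_smul, Real.norm_of_nonneg (by positivity)]
    rw [dist_eq_norm, lt_div_iff₀ ht0] at hbb
    rw [div_mul_eq_mul_div, div_lt_iff₀ h1]
    linarith
  have := T.starConvex hy' hb' h1.le ht0.le (by ring)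
  convert this using 1
  rw [smul_add, smul_smul, mul_div_cancel₀ _ h1.ne']
  module

theorem isCompact_face (i : Fin T.numFaces) : IsCompact (T.face i) := by
  obtain ⟨-, N, s, -, h⟩ := T.face_isPolytope i
  rw [h]
  exact isCompact_iUnion fun j => (finite_range _).isCompact_convexHull ℝ

theorem measurableSet_face (i : Fin T.numFaces) : MeasurableSet (T.face i) :=
  (T.isCompact_face i).measurableSet

theorem face_subset (i : Fin T.numFaces) : T.face i ⊆ frontier T.carrier := by
  rw [← T.iUnion_face]; exact subset_iUnion _ i

theorem face_nonempty (i : Fin T.numFaces) : (T.face i).Nonempty := (T.face_isPolytope i).1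

theorem inner_normal_face (i : Fin T.numFaces) (y : Space d) {x x' : Space d} (hx : x ∈ T.face i)
    (hx' : x' ∈ T.face i) : inner ℝ (T.normal i) (x - y) = inner ℝ (T.normal i) (x' - y) := by
  have := T.face_planar i x hx x' hx'
  rw [show x' - y = (x' - x) + (x - y) by abel, inner_add_right, this, zero_add]

theorem face_lt_top (i : Fin T.numFaces) :
    (Measure.euclideanHausdorffMeasure (d - 1) : Measure (Space d)) (T.face i) < ⊤ := by
  obtain ⟨b, hb⟩ := T.face_nonempty i
  exact euclideanHausdorffMeasure_lt_top b (T.norm_normal i)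
    (fun x hx => T.face_planar i b hb x hx) (T.isCompact_face i).isBounded

/-- The surface measure of a face, as a measure on the whole space. -/
def faceSurface (i : Fin T.numFaces) : Measure (Space d) :=
  (Measure.euclideanHausdorffMeasure (d - 1)).restrict (T.face i)

instance (i : Fin T.numFaces) : IsFiniteMeasure (T.faceSurface i) := by
  constructor
  rw [faceSurface, Measure.restrict_apply_univ]
  exact T.face_lt_top i

instance : IsFiniteMeasure T.surface := by
  constructor
  rw [surface, Measure.restrict_apply_univ, ← T.iUnion_face]
  exact (measure_iUnion_le _).trans_lt (by
    rw [tsum_fintype]; exact ENNReal.sum_lt_top.2 fun i _ => T.face_lt_top i)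

instance : IsFiniteMeasure (volume.restrict T.carrier) := by
  constructor
  rw [Measure.restrict_apply_univ]
  exact T.isBounded.measure_lt_top

/-- The segment from `x` towards `y` enters the cell at once, and near `x` the cell is the
half-space opposite to the normal. -/
theorem inner_normal_pos {i : Fin T.numFaces} {x : Space d} (hx : x ∈ T.face i)
    (hne : ∀ j, j ≠ i → x ∉ T.face j) {y : Space d} (hy : y ∈ T.kernelBall) :
    0 < inner ℝ (T.normal i) (x - y) := by
  obtain ⟨r, hr, h⟩ := T.normal_outward i x hx hne
  have hlim : Tendsto (fun s : ℝ => x + s • (y - x)) (𝓝[>] 0) (𝓝 x) := by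
    have : Continuous (fun s : ℝ => x + s • (y - x)) := by fun_prop
    simpa using (this.tendsto 0).mono_left nhdsWithin_le_nhds
  have h1 := hlim.eventually (Metric.ball_mem_nhds x hr)
  have h2 : ∀ᶠ s : ℝ in 𝓝[>] 0, s ∈ Ioc (0 : ℝ) 1 := Ioc_mem_nhdsGT zero_lt_one
  obtain ⟨s, hs1, hs2⟩ := (h1.and h2).exists
  have hmem : x + s • (y - x) ∈ T.carrier := by
    have := T.segment_mem hy (frontier_subset_closure (T.face_subset i hx))
      (t := 1 - s) ⟨by linarith [hs2.2], by linarith [hs2.1]⟩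
    convert this using 1
    module
  have := (h _ hs1).1 hmem
  rw [add_sub_cancel_left, inner_smul_right] at this
  have h3 : inner ℝ (T.normal i) (y - x) < 0 := by
    by_contra hcon
    push Not at hcon
    nlinarith [hs2.1]
  rw [← neg_sub, inner_neg_right]
  linarith

/-- Otherwise the face would be covered by its finitely many null overlaps with other faces. Such a
point is what makes `normal_outward` usable on the face. -/
theorem exists_mem_face_only {i : Fin T.numFaces}
    (h : (Measure.euclideanHausdorffMeasure (d - 1) : Measure (Space d)) (T.face i) ≠ 0) :
    ∃ x ∈ T.face i, ∀ j, j ≠ i → x ∉ T.face j := by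
  by_contra! hcon
  refine h (measure_mono_null (t := ⋃ j : {j // j ≠ i}, T.face i ∩ T.face j) ?_ ?_)
  · intro x hx
    obtain ⟨j, hj, hxj⟩ := hcon x hx
    exact mem_iUnion.2 ⟨⟨j, hj⟩, hx, hxj⟩
  · exact measure_iUnion_null fun j => T.face_inter i j j.2.symm

/-- The part of the ray from `y` beyond `x` is connected, starts in the cell and leaves it by
boundedness, so it meets the frontier. -/
theorem exists_frontier {y x : Space d} (hx : x ∈ T.carrier) (hne : x ≠ y) :
    ∃ b ∈ frontier T.carrier, ∃ t ∈ Ioo (0 : ℝ) 1, x = y + t • (b - y) := by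
  have hpre : IsPreconnected ((fun s : ℝ => y + s • (x - y)) '' Ici 1) :=
    isPreconnected_Ici.image _ (by fun_prop)
  have hunb : ∃ s : ℝ, 1 ≤ s ∧ y + s • (x - y) ∉ T.carrier := by
    obtain ⟨R, hR⟩ := T.isBounded.subset_ball y
    have hpos : 0 < ‖x - y‖ := norm_pos_iff.2 (sub_ne_zero.2 hne)
    refine ⟨max 1 (R / ‖x - y‖), le_max_left _ _, fun hmem => ?_⟩
    have := hR hmem
    rw [mem_ball_iff_norm, add_sub_cancel_left, norm_smul, Real.norm_of_nonneg (by positivity)]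
      at this
    have h2 : R / ‖x - y‖ * ‖x - y‖ ≤ max 1 (R / ‖x - y‖) * ‖x - y‖ :=
      mul_le_mul_of_nonneg_right (le_max_right _ _) hpos.le
    rw [div_mul_cancel₀ _ hpos.ne'] at h2
    linarith
  obtain ⟨s₀, hs₀, hout⟩ := hunb
  obtain ⟨b, ⟨s, hs, rfl⟩, hb⟩ :
      ((fun s : ℝ => y + s • (x - y)) '' Ici 1 ∩ frontier T.carrier).Nonempty := by
    by_contra hcon
    have hmem : ∀ z ∈ (fun s : ℝ => y + s • (x - y)) '' Ici 1, z ∉ T.carrier →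
        z ∈ (closure T.carrier)ᶜ := fun z hz hzT hzc =>
      hcon ⟨z, hz, T.isOpen.frontier_eq ▸ ⟨hzc, hzT⟩⟩
    obtain ⟨z, -, hz1, hz2⟩ := hpre T.carrier (closure T.carrier)ᶜ T.isOpen
      isClosed_closure.isOpen_compl
      (fun z hz => or_iff_not_imp_left.2 (hmem z hz)) ⟨x, ⟨1, by simp, by simp⟩, hx⟩
      ⟨_, ⟨s₀, hs₀, rfl⟩, hmem _ ⟨s₀, hs₀, rfl⟩ hout⟩
    exact hz2 (subset_closure hz1)
  have hs1 : 1 < s := by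
    refine lt_of_le_of_ne hs fun h => ?_
    subst h
    simp only [one_smul, add_sub_cancel] at hb
    exact (T.isOpen.frontier_eq ▸ hb).2 hx
  refine ⟨_, hb, s⁻¹, ⟨by positivity, inv_lt_one_of_one_lt₀ hs1⟩, ?_⟩
  rw [add_sub_cancel_left, smul_smul, inv_mul_cancel₀ (by positivity)]
  simp

theorem openCone_subset {y : Space d} (hy : y ∈ T.kernelBall) (i : Fin T.numFaces) :
    openCone y (T.face i) ⊆ T.carrier := by
  rintro x ⟨t, ht, b, hb, rfl⟩
  exact T.segment_mem hy (frontier_subset_closure (T.face_subset i hb)) ⟨ht.1.le, ht.2⟩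

theorem carrier_ae_eq {y : Space d} (hy : y ∈ T.kernelBall) (hd : 0 < d) :
    T.carrier =ᵐ[volume] ⋃ i, openCone y (T.face i) := by
  -- Positive dimension makes points null, so that the apex can be discarded.
  have : Nonempty (Fin d) := ⟨⟨0, hd⟩⟩
  refine Filter.EventuallyLE.antisymm ?_ (LE.le.eventuallyLE (iUnion_subset fun i => T.openCone_subset hy i))
  filter_upwards [compl_mem_ae_iff.2 (measure_singleton y)] with x hxy hx
  obtain ⟨b, hb, t, ht, rfl⟩ := T.exists_frontier hx hxy
  rw [← T.iUnion_face] at hb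
  obtain ⟨i, hi⟩ := mem_iUnion.1 hb
  exact mem_iUnion.2 ⟨i, t, ht, b, hi, rfl⟩

/-- A ray from `y` meets the frontier at most once: of two frontier points on it, the nearer would
lie in the open cell by `segment_mem`. -/
theorem openCone_inter {y : Space d} (hy : y ∈ T.kernelBall) (i j : Fin T.numFaces) :
    openCone y (T.face i) ∩ openCone y (T.face j) ⊆ openCone y (T.face i ∩ T.face j) := by
  have key : ∀ {b b' : Space d}, b ∈ frontier T.carrier → b' ∈ frontier T.carrier →
      ∀ {t t' : ℝ}, 0 < t → t < t' → y + t • (b - y) ≠ y + t' • (b' - y) := by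
    intro b b' hb hb' t t' ht htt h
    have : y + (t / t') • (b - y) = b' := by
      have h2 := add_left_cancel h
      rw [div_eq_inv_mul, ← smul_smul, h2, smul_smul, inv_mul_cancel₀ (by linarith)]
      simp
    have hmem := T.segment_mem hy (frontier_subset_closure hb) (t := t / t')
      ⟨div_nonneg ht.le (by linarith), (div_lt_one (by linarith)).2 htt⟩
    rw [this] at hmem
    exact (T.isOpen.frontier_eq ▸ hb').2 hmem
  rintro x ⟨⟨t, ht, b, hb, rfl⟩, ⟨t', ht', b', hb', h⟩⟩
  rcases lt_trichotomy t t' with htt | rfl | htt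
  · exact absurd h (key (T.face_subset i hb) (T.face_subset j hb') ht.1 htt)
  · have : b = b' := by
      have h2 := smul_right_injective _ ht.1.ne' (add_left_cancel h)
      simpa using h2
    exact ⟨t, ht, b, ⟨hb, this ▸ hb'⟩, rfl⟩
  · exact absurd h.symm (key (T.face_subset j hb') (T.face_subset i hb) ht'.1 htt)

theorem volume_openCone_inter {y : Space d} (hy : y ∈ T.kernelBall) {i j : Fin T.numFaces}
    (hij : i ≠ j) : volume (openCone y (T.face i) ∩ openCone y (T.face j)) = 0 := by
  obtain ⟨b, hb⟩ := T.face_nonempty i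
  exact measure_mono_null (T.openCone_inter hy i j) (volume_openCone_eq_zero y (T.norm_normal i)
    (fun x hx => T.inner_normal_face i y hx.1 hb)
    ((T.measurableSet_face i).inter (T.measurableSet_face j))
    ((T.isCompact_face i).isBounded.subset inter_subset_left) (T.face_inter i j hij))

/-- The explicit description of the cone needs a positive height, available only on faces of
positive measure; the cone over any other face is null. -/
theorem nullMeasurableSet_openCone {y : Space d} (hy : y ∈ T.kernelBall) (i : Fin T.numFaces) :
    NullMeasurableSet (openCone y (T.face i)) := by
  by_cases h : (Measure.euclideanHausdorffMeasure (d - 1) : Measure (Space d)) (T.face i) = 0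
  · obtain ⟨b, hb⟩ := T.face_nonempty i
    exact NullMeasurableSet.of_null (volume_openCone_eq_zero y (T.norm_normal i)
      (fun x hx => T.inner_normal_face i y hx hb) (T.measurableSet_face i)
      (T.isCompact_face i).isBounded h)
  · obtain ⟨b, hb, hne⟩ := T.exists_mem_face_only h
    exact (measurableSet_openCone y (T.inner_normal_pos hb hne hy)
      (fun x hx => T.inner_normal_face i y hx hb) (T.measurableSet_face i)).nullMeasurableSet

/-! ### The divergence theorem -/

theorem integral_radial_divergence (hd : 0 < d) {y : Space d} (hy : y ∈ T.kernelBall)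
    {f : Space d → ℝ} (hf : ContDiff ℝ 1 f) :
    ∫ x in T.carrier, (d * f x + fderiv ℝ f x (x - y)) =
      ∑ i, ∫ x, inner ℝ (T.normal i) (x - y) * f x ∂(T.faceSurface i) := by
  have hc : Continuous fun x => fderiv ℝ f x := hf.continuous_fderiv (by norm_num)
  have hcf : Continuous f := hf.continuous
  have hG : Continuous fun x => (d * f x + fderiv ℝ f x (x - y)) := by fun_prop
  rw [setIntegral_congr_set (T.carrier_ae_eq hy hd), integral_iUnion_ae
    (T.nullMeasurableSet_openCone hy) (fun i j hij => T.volume_openCone_inter hy hij)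
    ((hG.integrableOn_of_isBounded T.isBounded).mono_set
      (iUnion_subset fun i => T.openCone_subset hy i)), tsum_fintype]
  refine Finset.sum_congr rfl fun i _ => ?_
  by_cases h : (Measure.euclideanHausdorffMeasure (d - 1) : Measure (Space d)) (T.face i) = 0
  · obtain ⟨b, hb⟩ := T.face_nonempty i
    rw [faceSurface, Measure.restrict_eq_zero.2 h, integral_zero_measure,
      setIntegral_measure_zero _ (volume_openCone_eq_zero y (T.norm_normal i)
      (fun x hx => T.inner_normal_face i y hx hb) (T.measurableSet_face i)
      (T.isCompact_face i).isBounded h)]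
  · obtain ⟨b, hb, hne⟩ := T.exists_mem_face_only h
    exact integral_openCone hd y (T.norm_normal i) (T.inner_normal_pos hb hne hy)
      (fun x hx => T.inner_normal_face i y hx hb) (T.measurableSet_face i)
      (T.isCompact_face i).isBounded hf

theorem _root_.Continuous.integrable_faceSurface {F : Type*} [NormedAddCommGroup F]
    {f : Space d → F} (hf : Continuous f) (i : Fin T.numFaces) :
    Integrable f (T.faceSurface i) := by
  have := (T.isCompact_face i).exists_bound_of_continuousOn hf.continuousOn
  obtain ⟨C, hC⟩ := this
  refine Integrable.of_bound hf.aestronglyMeasurable C ?_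
  exact (ae_restrict_iff' (T.measurableSet_face i)).2 (Eventually.of_forall hC)

/-- The divergence theorem on a polytopal cell. -/
theorem integral_fderiv_eq (hd : 0 < d) {f : Space d → ℝ} (hf : ContDiff ℝ 1 f) (e : Space d) :
    ∫ x in T.carrier, fderiv ℝ f x e =
      ∑ i, ∫ x, f x * inner ℝ (T.normal i) e ∂(T.faceSurface i) := by
  have hc : Continuous fun x => fderiv ℝ f x := hf.continuous_fderiv (by norm_num)
  have hcf : Continuous f := hf.continuous
  -- The radial identity is used at the apices `c - s e` and `c`. In the difference only `s * fderiv
  -- ℝ f x e` survives inside and `s * inner ℝ n e * f x` on the faces.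
  obtain ⟨s, hs, hmem⟩ : ∃ s : ℝ, 0 < s ∧ T.center - s • e ∈ T.kernelBall := by
    have hlim : Tendsto (fun s : ℝ => T.center - s • e) (𝓝[>] 0) (𝓝 T.center) := by
      have : Continuous (fun s : ℝ => T.center - s • e) := by fun_prop
      simpa using (this.tendsto 0).mono_left nhdsWithin_le_nhds
    have h1 := hlim.eventually (Metric.ball_mem_nhds T.center T.radius_pos)
    obtain ⟨s, h2, h3⟩ := (h1.and self_mem_nhdsWithin).exists
    exact ⟨s, h3, h2⟩
  have h1 := T.integral_radial_divergence hd hmem hf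
  have h2 := T.integral_radial_divergence hd T.center_mem hf
  have h3 : ∫ x in T.carrier, s * fderiv ℝ f x e =
      ∑ i, ∫ x, s * (f x * inner ℝ (T.normal i) e) ∂(T.faceSurface i) := by
    have e1 : ∀ x, s * fderiv ℝ f x e = (d * f x + fderiv ℝ f x (x - (T.center - s • e))) -
        (d * f x + fderiv ℝ f x (x - T.center)) := by
      intro x
      rw [show x - (T.center - s • e) = (x - T.center) + s • e by abel, map_add, map_smul,
        smul_eq_mul]
      ring
    simp_rw [e1]
    rw [integral_sub, h1, h2, ← Finset.sum_sub_distrib]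
    · refine Finset.sum_congr rfl fun i _ => ?_
      rw [← integral_sub]
      · congr 1
        ext x
        rw [show x - (T.center - s • e) = (x - T.center) + s • e by abel, inner_add_right,
          inner_smul_right]
        ring
      · exact Continuous.integrable_faceSurface T (by fun_prop) i
      · exact Continuous.integrable_faceSurface T (by fun_prop) i
    · exact Continuous.integrableOn_of_isBounded (by fun_prop) T.isBounded
    · exact Continuous.integrableOn_of_isBounded (by fun_prop) T.isBounded
  simp_rw [integral_const_mul, ← Finset.mul_sum] at h3
  exact mul_left_cancel₀ hs.ne' h3

end PolytopalCell

/-! ### Averages and `L²` convergence -/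

open scoped Convolution

open ContinuousLinearMap (lsmul)

theorem eLpNorm_two_sq {α F : Type*} [MeasurableSpace α] [NormedAddCommGroup F] (μ : Measure α)
    (f : α → F) : eLpNorm f 2 μ ^ 2 = ∫⁻ x, ‖f x‖ₑ ^ 2 ∂μ := by
  have := eLpNorm_nnreal_pow_eq_lintegral (f := f) (μ := μ) (p := 2) (by norm_num)
  simpa using this

theorem pow_two_le_pow_two_iff {a b : ENNReal} : a ^ 2 ≤ b ^ 2 ↔ a ≤ b :=
  ENNReal.pow_le_pow_left_iff two_ne_zero

/-- Since `φ dt` is a probability measure, the square of a mean is at most the mean of the squares;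
Tonelli and translation invariance then give the bound. -/
theorem eLpNorm_two_convolution_le {d : ℕ} {F : Type*} [NormedAddCommGroup F] [NormedSpace ℝ F]
    {φ : Space d → ℝ} (hφ : Continuous φ) (hφ0 : ∀ x, 0 ≤ φ x) (hφ1 : ∫ x, φ x = 1)
    {f : Space d → F} (hf : AEStronglyMeasurable f volume) :
    eLpNorm (φ ⋆[lsmul ℝ ℝ, volume] f) 2 volume ≤ eLpNorm f 2 volume := by
  obtain ⟨g, hg, hfg⟩ := hf
  rw [convolution_congr (lsmul ℝ ℝ) (ae_eq_refl φ) hfg, eLpNorm_congr_ae hfg]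
  set ν : Measure (Space d) := volume.withDensity fun x => ENNReal.ofReal (φ x) with hν
  have hprob : IsProbabilityMeasure ν := by
    constructor
    rw [hν, withDensity_apply _ MeasurableSet.univ, Measure.restrict_univ,
      ← ofReal_integral_eq_lintegral_ofReal (integrable_of_integral_eq_one hφ1)
        (Eventually.of_forall hφ0), hφ1, ENNReal.ofReal_one]
  rw [← pow_two_le_pow_two_iff, eLpNorm_two_sq, eLpNorm_two_sq]
  have hpt : ∀ x, ‖(φ ⋆[lsmul ℝ ℝ, volume] g) x‖ₑ ^ 2 ≤ ∫⁻ t, ‖g (x - t)‖ₑ ^ 2 ∂ν := by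
    intro x
    rw [← eLpNorm_two_sq ν fun t => g (x - t), pow_two_le_pow_two_iff]
    have hmeas : StronglyMeasurable fun t => g (x - t) := hg.comp_measurable (by fun_prop)
    refine le_trans ?_ (eLpNorm_le_eLpNorm_of_exponent_le (p := 1) (by norm_num)
      hmeas.aestronglyMeasurable)
    rw [eLpNorm_one_eq_lintegral_enorm, convolution_def]
    refine (enorm_integral_le_lintegral_enorm _).trans ?_
    rw [hν, lintegral_withDensity_eq_lintegral_mul _ (by fun_prop) hmeas.enorm]
    refine lintegral_mono fun t => ?_
    simp only [ContinuousLinearMap.lsmul_apply, enorm_smul, Pi.mul_apply]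
    rw [Real.enorm_of_nonneg (hφ0 t)]
  refine (lintegral_mono hpt).trans ?_
  rw [lintegral_lintegral_swap]
  · have : ∀ t : Space d, ∫⁻ x, ‖g (x - t)‖ₑ ^ 2 = ∫⁻ x, ‖g x‖ₑ ^ 2 := fun t =>
      lintegral_sub_right_eq_self (fun x => ‖g x‖ₑ ^ 2) t
    simp [this]
  · refine Measurable.aemeasurable ?_
    exact ((hg.comp_measurable (measurable_fst.sub measurable_snd)).enorm).pow_const 2

/-- The Jacobian factor `l ^ (-d)` is at most `2 ^ d`, uniformly for `l ≥ 1 / 2`. -/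
theorem eLpNorm_two_comp_smul_add {d : ℕ} {F : Type*} [NormedAddCommGroup F]
    {g : Space d → F} (hg : AEStronglyMeasurable g volume) {l : ℝ} (hl : 1 / 2 ≤ l) (a : Space d) :
    eLpNorm (fun x => g (l • x + a)) 2 volume ≤
      ENNReal.ofReal (2 ^ d) ^ (1 / 2 : ℝ) * eLpNorm g 2 volume := by
  have hl0 : 0 < l := by linarith
  have hmap : (volume : Measure (Space d)).map (fun x => l • x + a) =
      ENNReal.ofReal (|(l ^ d)⁻¹|) • volume := by
    have h1 := Measure.map_addHaar_smul (volume : Measure (Space d)) hl0.ne'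
    rw [finrank_euclideanSpace_fin] at h1
    have : (fun x : Space d => l • x + a) = (fun x => x + a) ∘ (l • ·) := rfl
    rw [this, ← Measure.map_map (by fun_prop) (by fun_prop), h1, Measure.map_smul, map_add_right_eq_self]
  have hg' : AEStronglyMeasurable g ((volume : Measure (Space d)).map (fun x => l • x + a)) := by
    rw [hmap]; exact hg.smul_measure _
  have := eLpNorm_map_measure (p := 2) hg' (by fun_prop)
  rw [hmap, eLpNorm_smul_measure_of_ne_top (by norm_num)] at this
  rw [show (fun x => g (l • x + a)) = g ∘ fun x => l • x + a from rfl, ← this, smul_eq_mul]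
  refine mul_le_mul' ?_ le_rfl
  have h2 : ENNReal.ofReal (|(l ^ d)⁻¹|) ≤ ENNReal.ofReal (2 ^ d) := by
    refine ENNReal.ofReal_le_ofReal ?_
    rw [abs_of_pos (by positivity), ← inv_pow]
    refine pow_le_pow_left₀ (by positivity) ?_ d
    rw [inv_le_comm₀ hl0 (by norm_num)]
    linarith
  simpa using ENNReal.rpow_le_rpow h2 (by norm_num : (0 : ℝ) ≤ 1 / 2)

/-- The mean, with weight `φ`, of the values of `f` near the point `l • x + (1 - l) • c`. -/
def shrinkAverage {d : ℕ} {F : Type*} [NormedAddCommGroup F] [NormedSpace ℝ F] (φ : Space d → ℝ)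
    (l : ℝ) (c : Space d) (f : Space d → F) (x : Space d) : F :=
  (φ ⋆[lsmul ℝ ℝ, volume] f) (l • x + (1 - l) • c)

/-- A sequence of smooth averaging kernels, the `n`-th one supported in the ball of radius
`(1 - l n) * ρ`, with `l n` tending to `1` from below. -/
structure ShrinkKernels (d : ℕ) (ρ : ℝ) where
  /-- the kernels -/
  kernel : ℕ → Space d → ℝ
  /-- the contraction factors -/
  factor : ℕ → ℝ
  half_le : ∀ n, 1 / 2 ≤ factor n
  lt_one : ∀ n, factor n < 1
  tendsto_factor : Tendsto factor atTop (𝓝 1)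
  contDiff : ∀ n, ContDiff ℝ ∞ (kernel n)
  hasCompactSupport : ∀ n, HasCompactSupport (kernel n)
  nonneg : ∀ n x, 0 ≤ kernel n x
  integral_eq_one : ∀ n, ∫ x, kernel n x = 1
  tsupport_subset : ∀ n, tsupport (kernel n) ⊆ Metric.ball 0 ((1 - factor n) * ρ)

theorem nonempty_shrinkKernels (d : ℕ) {ρ : ℝ} (hρ : 0 < ρ) : Nonempty (ShrinkKernels d ρ) := by
  -- The shift by `2` makes the first factor equal to `1 / 2`, the lower bound required.
  let l : ℕ → ℝ := fun n => 1 - 1 / ((n : ℝ) + 2)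
  have hl : ∀ n, l n < 1 := fun n => by
    have : 0 < 1 / ((n : ℝ) + 2) := by positivity
    simp only [l]; linarith
  have hpos : ∀ n, 0 < (1 - l n) * ρ := fun n => mul_pos (by linarith [hl n]) hρ
  let φ : ∀ n, ContDiffBump (0 : Space d) := fun n =>
    -- The outer radius is half of the permitted one, so that the closed support fits into the open
    -- ball.
    ⟨(1 - l n) * ρ / 4, (1 - l n) * ρ / 2, by linarith [hpos n], by linarith [hpos n]⟩
  refine ⟨⟨fun n => (φ n).normed volume, l, fun n => ?_, hl, ?_, fun n => (φ n).contDiff_normed,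
    fun n => (φ n).hasCompactSupport_normed, fun n x => (φ n).nonneg_normed x,
    fun n => (φ n).integral_normed, fun n => ?_⟩⟩
  · have : 1 / ((n : ℝ) + 2) ≤ 1 / 2 := by gcongr; linarith [(n.cast_nonneg : (0 : ℝ) ≤ n)]
    simp only [l]; linarith
  · have h1 := tendsto_one_div_add_atTop_nhds_zero_nat (𝕜 := ℝ)
    have h2 := (tendsto_add_atTop_iff_nat 1).2 h1
    have h3 := h2.const_sub 1
    simp only [sub_zero] at h3
    refine h3.congr fun n => ?_
    simp only [l]; push_cast; ring
  · rw [(φ n).tsupport_normed_eq]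
    exact Metric.closedBall_subset_ball (by linarith [hpos n] : (1 - l n) * ρ / 2 < (1 - l n) * ρ)

/-- Approximation by a continuous compactly supported `g`: averaging is bounded on `L²` uniformly in
`n`, and on `g` it converges uniformly over `S`. -/
theorem tendsto_eLpNorm_shrinkAverage {d : ℕ} {F : Type*} [NormedAddCommGroup F] [NormedSpace ℝ F]
    [CompleteSpace F] {ρ : ℝ} (K : ShrinkKernels d ρ) (c : Space d) {S : Set (Space d)}
    (hS : Bornology.IsBounded S) (hSm : MeasurableSet S) {f : Space d → F} (hf : MemLp f 2 volume) :
    Tendsto (fun n => eLpNorm (fun x => shrinkAverage (K.kernel n) (K.factor n) c f x - f x) 2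
      (volume.restrict S)) atTop (𝓝 0) := by
  set C : ENNReal := ENNReal.ofReal (2 ^ d) ^ (1 / 2 : ℝ) with hC
  have hCtop : C ≠ ⊤ := ENNReal.rpow_ne_top_of_nonneg (by norm_num) ENNReal.ofReal_ne_top
  have hSfin : (volume.restrict S) univ ^ (2 : ENNReal).toReal⁻¹ ≠ ⊤ := by
    refine ENNReal.rpow_ne_top_of_nonneg (by norm_num) ?_
    rw [Measure.restrict_apply_univ]
    exact hS.measure_lt_top.ne
  rw [ENNReal.tendsto_nhds_zero]
  intro ε hε
  -- Budget: `C δ` for the average of `f - g`, `δ` for the averaging error of `g`, `δ` for `g - f`.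
  obtain ⟨δ, hδ, hδε⟩ := ENNReal.exists_nnreal_pos_mul_lt (a := C + 1 + 1)
    (by simp [hCtop]) hε.ne'
  obtain ⟨δ', hδ', hδδ'⟩ := ENNReal.exists_nnreal_pos_mul_lt hSfin
    (b := (δ : ENNReal)) (by simpa using hδ.ne')
  obtain ⟨g, hgc, hfg, hg, hg2⟩ := hf.exists_hasCompactSupport_eLpNorm_sub_le (by norm_num)
    (ε := (δ : ENNReal)) (by simpa using hδ.ne')
  obtain ⟨r, hr, hgr⟩ := Metric.uniformContinuous_iff.1
    (hgc.uniformContinuous_of_continuous hg) δ' (by exact_mod_cast hδ')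
  obtain ⟨R, hR⟩ := hS.subset_closedBall c
  -- Sampled points lie within `(1 - l) ρ` of the contracted point, which is within `(1 - l) R` of
  -- `x`.
  have hsmall : ∀ᶠ n in atTop, (1 - K.factor n) * (ρ + R) < r := by
    have h1 : Tendsto (fun n => (1 - K.factor n) * (ρ + R)) atTop (𝓝 ((1 - 1) * (ρ + R))) :=
      (K.tendsto_factor.const_sub 1).mul_const _
    rw [sub_self, zero_mul] at h1
    exact h1.eventually_lt_const hr
  filter_upwards [hsmall] with n hn
  have hl : 0 < 1 - K.factor n := by linarith [K.lt_one n]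
  have hexists : ∀ {u : Space d → F}, MemLp u 2 volume →
      ConvolutionExists (K.kernel n) u (lsmul ℝ ℝ) volume := fun hu =>
    (K.hasCompactSupport n).convolutionExists_left _ (K.contDiff n).continuous
      (hu.locallyIntegrable (by norm_num))
  have hcont : ∀ {u : Space d → F}, MemLp u 2 volume →
      Continuous (K.kernel n ⋆[lsmul ℝ ℝ, volume] u) := fun hu =>
    (K.hasCompactSupport n).continuous_convolution_left _ (K.contDiff n).continuous
      (hu.locallyIntegrable (by norm_num))
  have haff : Continuous fun x : Space d => K.factor n • x + (1 - K.factor n) • c := by fun_prop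
  have hfg2 : MemLp (f - g) 2 volume := hf.sub hg2
  have hsplit : (fun x => shrinkAverage (K.kernel n) (K.factor n) c f x - f x) =
      shrinkAverage (K.kernel n) (K.factor n) c (f - g) +
        ((fun x => shrinkAverage (K.kernel n) (K.factor n) c g x - g x) + (g - f)) := by
    have h1 := (hexists hfg2).distrib_add (hexists hg2)
    rw [sub_add_cancel] at h1
    ext x
    simp only [shrinkAverage, h1, Pi.add_apply, Pi.sub_apply]
    abel
  have hm1 : AEStronglyMeasurable (shrinkAverage (K.kernel n) (K.factor n) c (f - g))
      (volume.restrict S) := ((hcont hfg2).comp haff).aestronglyMeasurable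
  have hm2 : AEStronglyMeasurable (fun x => shrinkAverage (K.kernel n) (K.factor n) c g x - g x)
      (volume.restrict S) := (((hcont hg2).comp haff).sub hg).aestronglyMeasurable
  have hm3 : AEStronglyMeasurable (g - f) (volume.restrict S) :=
    (hg2.sub hf).aestronglyMeasurable.restrict
  have e1 : eLpNorm (shrinkAverage (K.kernel n) (K.factor n) c (f - g)) 2 (volume.restrict S) ≤
      C * δ := by
    refine (eLpNorm_mono_measure _ Measure.restrict_le_self).trans ?_
    refine (eLpNorm_two_comp_smul_add (hcont hfg2).aestronglyMeasurable (K.half_le n) _).trans ?_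
    refine mul_le_mul' le_rfl ?_
    exact (eLpNorm_two_convolution_le (K.contDiff n).continuous (K.nonneg n) (K.integral_eq_one n)
      hfg2.aestronglyMeasurable).trans hfg
  have e2 : eLpNorm (fun x => shrinkAverage (K.kernel n) (K.factor n) c g x - g x) 2
      (volume.restrict S) ≤ δ := by
    have hb : ∀ᵐ x ∂(volume.restrict S),
        ‖shrinkAverage (K.kernel n) (K.factor n) c g x - g x‖ ≤ δ' := by
      refine (ae_restrict_iff' hSm).2 (Eventually.of_forall fun x hx => ?_)
      rw [← dist_eq_norm]
      refine dist_convolution_le (by positivity)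
        ((subset_tsupport _).trans (K.tsupport_subset n)) (K.nonneg n) (K.integral_eq_one n)
        hg.aestronglyMeasurable fun z hz => (hgr ?_).le
      have hxR := hR hx
      rw [mem_closedBall_iff_norm] at hxR
      rw [mem_ball_iff_norm] at hz
      rw [dist_eq_norm, show z - x = (z - (K.factor n • x + (1 - K.factor n) • c)) +
        (1 - K.factor n) • (c - x) by module]
      refine (norm_add_le _ _).trans_lt ?_
      rw [norm_smul, Real.norm_of_nonneg hl.le, norm_sub_rev c x]
      nlinarith
    refine (eLpNorm_le_of_ae_bound hb).trans ?_
    rw [mul_comm]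
    simpa using hδδ'.le
  have e3 : eLpNorm (g - f) 2 (volume.restrict S) ≤ δ := by
    rw [eLpNorm_sub_comm]
    exact (eLpNorm_mono_measure _ Measure.restrict_le_self).trans hfg
  rw [hsplit]
  refine (eLpNorm_add_le hm1 (hm2.add hm3) (by norm_num)).trans ?_
  refine (add_le_add e1 ((eLpNorm_add_le hm2 hm3 (by norm_num)).trans (add_le_add e2 e3))).trans ?_
  refine le_trans (le_of_eq ?_) hδε.le
  ring

/-! ### Smooth functions are dense in `H¹` -/

theorem contDiff_shrinkAverage {d : ℕ} {F : Type*} [NormedAddCommGroup F] [NormedSpace ℝ F]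
    [CompleteSpace F] {φ : Space d → ℝ} (hφ : ContDiff ℝ ∞ φ) (hc : HasCompactSupport φ)
    (l : ℝ) (c : Space d) {f : Space d → F} (hf : LocallyIntegrable f volume) :
    ContDiff ℝ ∞ (shrinkAverage φ l c f) :=
  (hc.contDiff_convolution_left _ hφ hf).comp (by fun_prop)

/-- The derivative falls on the kernel, so `f` need not be differentiable; the factor `l` is the
chain rule for the contraction. -/
theorem fderiv_shrinkAverage {d : ℕ} {φ : Space d → ℝ} (hφ : ContDiff ℝ ∞ φ)
    (hc : HasCompactSupport φ) (l : ℝ) (c : Space d) {f : Space d → Space d}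
    (hf : LocallyIntegrable f volume) (x e : Space d) (i : Fin d) :
    fderiv ℝ (shrinkAverage φ l c f) x e i =
      l * ∫ z, f z i * fderiv ℝ φ (l • x + (1 - l) • c - z) e := by
  set X : Space d := l • x + (1 - l) • c with hX
  have hφ1 : ContDiff ℝ 1 φ := hφ.of_le (by simp)
  have h1 := hc.hasFDerivAt_convolution_left (lsmul ℝ ℝ) hφ1 hf X
  have h2 : HasFDerivAt (fun x : Space d => l • x + (1 - l) • c)
      (l • ContinuousLinearMap.id ℝ (Space d)) x :=
    ((hasFDerivAt_id x).const_smul l).add_const _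
  have h3 : fderiv ℝ (shrinkAverage φ l c f) x = _ := (h1.comp x h2).fderiv
  rw [h3]
  simp only [ContinuousLinearMap.comp_apply, _root_.smul_apply,
    ContinuousLinearMap.id_apply, map_smul, PiLp.smul_apply, smul_eq_mul]
  congr 1
  let Λ : (Space d →L[ℝ] Space d) →L[ℝ] ℝ :=
    (EuclideanSpace.proj i : Space d →L[ℝ] ℝ) ∘L (ContinuousLinearMap.apply ℝ (Space d) e)
  have hex : ConvolutionExistsAt (fderiv ℝ φ) f X ((lsmul ℝ ℝ).precompL (Space d)) volume :=
    (hc.fderiv ℝ).convolutionExists_left _ (hφ1.continuous_fderiv (by norm_num)) hf X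
  have h4 := Λ.integral_comp_comm hex.integrable_swap
  rw [convolution_eq_swap]
  refine h4.symm.trans (integral_congr_ae (Eventually.of_forall fun z => ?_))
  simp [Λ, ContinuousLinearMap.precompL_apply, mul_comm]

namespace PolytopalCell

variable {d : ℕ} (T : PolytopalCell d)

/-- The extension by zero outside the cell. -/
def extend {F : Type*} [Zero F] (f : Space d → F) : Space d → F := T.carrier.indicator f

theorem measurableSet_carrier : MeasurableSet T.carrier := T.isOpen.measurableSet

theorem memLp_extend {F : Type*} [NormedAddCommGroup F] {f : Space d → F}
    (hf : MemLp f 2 (volume.restrict T.carrier)) : MemLp (T.extend f) 2 volume :=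
  (memLp_indicator_iff_restrict T.measurableSet_carrier).2 hf

theorem extend_ae_eq {F : Type*} [Zero F] (f : Space d → F) :
    T.extend f =ᵐ[volume.restrict T.carrier] f :=
  indicator_ae_eq_restrict T.measurableSet_carrier

/-- The shifted kernel `z ↦ kernel (X - z)` is a legitimate test function for the weak gradient: its
support lies in `l x + (1 - l)` times the kernel ball, hence in the cell. The extension by zero is
thus never differentiated across the boundary. -/
theorem fderiv_shrinkAverage_extend (K : ShrinkKernels d T.radius) (v : H1 T) (n : ℕ)
    {x : Space d} (hx : x ∈ T.carrier) (i j : Fin d) :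
    fderiv ℝ (shrinkAverage (K.kernel n) (K.factor n) T.center (T.extend v.toFun)) x
        (EuclideanSpace.single j 1) i =
      K.factor n * shrinkAverage (K.kernel n) (K.factor n) T.center
        (T.extend fun x => v.grad x i j) x := by
  rw [fderiv_shrinkAverage (K.contDiff n) (K.hasCompactSupport n) _ _
    ((T.memLp_extend v.memLp).locallyIntegrable (by norm_num))]
  congr 1
  set X : Space d := K.factor n • x + (1 - K.factor n) • T.center with hX
  let ψ : Space d → ℝ := fun z => K.kernel n (X - z)
  have hψ : ContDiff ℝ ∞ ψ := (K.contDiff n).comp (by fun_prop)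
  have hts : tsupport ψ ⊆ (fun z => X - z) ⁻¹' tsupport (K.kernel n) :=
    tsupport_comp_subset_preimage _ (by fun_prop)
  have hcs : HasCompactSupport ψ :=
    (K.hasCompactSupport n).comp_homeomorph (Homeomorph.subLeft X)
  have hsub : tsupport ψ ⊆ T.carrier := by
    intro z hz
    have h1 := K.tsupport_subset n (hts hz)
    rw [mem_ball_zero_iff] at h1
    have hl : 0 < 1 - K.factor n := by linarith [K.lt_one n]
    -- This is the `y` with `z = l x + (1 - l) y`.
    have hy : T.center - (1 - K.factor n)⁻¹ • (X - z) ∈ T.kernelBall := by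
      rw [kernelBall, mem_ball_iff_norm, sub_sub_cancel_left, norm_neg, norm_smul, norm_inv,
        Real.norm_of_nonneg hl.le, inv_mul_lt_iff₀ hl]
      exact h1
    have := T.segment_mem hy (subset_closure hx) (t := K.factor n)
      ⟨by linarith [K.half_le n], K.lt_one n⟩
    convert this using 1
    have h2 : z = K.factor n • x + (1 - K.factor n) • (T.center - (1 - K.factor n)⁻¹ • (X - z)) := by
      rw [smul_sub, smul_smul, mul_inv_cancel₀ hl.ne', hX]
      module
    nth_rewrite 1 [h2]
    module
  have hw := v.weak_grad ψ hψ hcs hsub i j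
  have hderiv : ∀ z, fderiv ℝ ψ z (EuclideanSpace.single j 1) =
      - fderiv ℝ (K.kernel n) (X - z) (EuclideanSpace.single j 1) := by
    intro z
    have h1 : HasFDerivAt (fun z : Space d => X - z) (-ContinuousLinearMap.id ℝ (Space d)) z :=
      (hasFDerivAt_id z).const_sub X
    have h2 : fderiv ℝ ψ z = _ := ((((K.contDiff n).differentiable (by simp)) (X - z)).hasFDerivAt.comp z h1).fderiv
    rw [h2]
    simp
  simp only [hderiv, mul_neg, integral_neg, neg_inj] at hw
  rw [shrinkAverage, convolution_lsmul_swap, ← hX]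
  calc ∫ z, T.extend v.toFun z i * fderiv ℝ (K.kernel n) (X - z) (EuclideanSpace.single j 1)
      = ∫ z in T.carrier, v.toFun z i *
          fderiv ℝ (K.kernel n) (X - z) (EuclideanSpace.single j 1) := by
        rw [← integral_indicator T.measurableSet_carrier]
        refine integral_congr_ae (Eventually.of_forall fun z => ?_)
        by_cases hz : z ∈ T.carrier <;> simp [extend, hz]
    _ = ∫ z in T.carrier, v.grad z i j * ψ z := hw
    _ = _ := by
        rw [← integral_indicator T.measurableSet_carrier]
        refine integral_congr_ae (Eventually.of_forall fun z => ?_)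
        by_cases hz : z ∈ T.carrier <;> simp [extend, hz, ψ, mul_comm]

/-- `H¹` fields are limits of smooth fields in `H¹`. -/
theorem exists_smooth_tendsto (v : H1 T) : ∃ u : ℕ → Space d → Space d,
    (∀ n, ContDiff ℝ ∞ (u n)) ∧
    Tendsto (fun n => eLpNorm (fun x => u n x - v.toFun x) 2 (volume.restrict T.carrier))
      atTop (𝓝 0) ∧
    (∀ i j, Tendsto (fun n => eLpNorm
        (fun x => fderiv ℝ (u n) x (EuclideanSpace.single j 1) i - v.grad x i j) 2
        (volume.restrict T.carrier)) atTop (𝓝 0)) := by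
  obtain ⟨K⟩ := nonempty_shrinkKernels d T.radius_pos
  refine ⟨fun n => shrinkAverage (K.kernel n) (K.factor n) T.center (T.extend v.toFun),
    fun n => contDiff_shrinkAverage (K.contDiff n) (K.hasCompactSupport n) _ _
      ((T.memLp_extend v.memLp).locallyIntegrable (by norm_num)), ?_, fun i j => ?_⟩
  · refine (tendsto_eLpNorm_shrinkAverage K T.center T.isBounded T.measurableSet_carrier
      (T.memLp_extend v.memLp)).congr fun n => eLpNorm_congr_ae ?_
    filter_upwards [T.extend_ae_eq v.toFun] with x hx
    rw [hx]
  · have hg := T.memLp_extend (v.memLp_grad i j)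
    set g := T.extend fun x => v.grad x i j with hgdef
    have h1 := tendsto_eLpNorm_shrinkAverage K T.center T.isBounded T.measurableSet_carrier hg
    -- The gradient of the average is `l` times the average `A g`; its error splits as `l (A g - g)
    -- + (l - 1) g`, and this controls the second term.
    have h2 : Tendsto (fun n => ‖K.factor n - 1‖ₑ * eLpNorm g 2 volume) atTop (𝓝 0) := by
      have h3 : Tendsto (fun n => ‖K.factor n - 1‖ₑ) atTop (𝓝 0) := by
        have := (K.tendsto_factor.sub_const 1).enorm
        simpa using this
      simpa using ENNReal.Tendsto.mul_const h3 (Or.inr hg.eLpNorm_ne_top)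
    have h4 := h1.add h2
    rw [add_zero] at h4
    refine tendsto_of_tendsto_of_tendsto_of_le_of_le tendsto_const_nhds h4 (fun n => zero_le)
      fun n => ?_
    have hcont : Continuous (shrinkAverage (K.kernel n) (K.factor n) T.center g) :=
      (contDiff_shrinkAverage (K.contDiff n) (K.hasCompactSupport n) _ _
        (hg.locallyIntegrable (by norm_num))).continuous
    have hae : (fun x => fderiv ℝ (shrinkAverage (K.kernel n) (K.factor n) T.center
          (T.extend v.toFun)) x (EuclideanSpace.single j 1) i - v.grad x i j)
        =ᵐ[volume.restrict T.carrier]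
        (K.factor n • (fun x => shrinkAverage (K.kernel n) (K.factor n) T.center g x - g x)) +
          ((K.factor n - 1) • g) := by
      filter_upwards [T.extend_ae_eq fun x => v.grad x i j,
        ae_restrict_mem T.measurableSet_carrier] with x hx hxT
      rw [T.fderiv_shrinkAverage_extend K v n hxT, ← hx, ← hgdef]
      simp only [Pi.add_apply, Pi.smul_apply, smul_eq_mul]
      ring
    have hm : AEStronglyMeasurable
        (fun x => shrinkAverage (K.kernel n) (K.factor n) T.center g x - g x)
        (volume.restrict T.carrier) :=
      hcont.aestronglyMeasurable.sub hg.aestronglyMeasurable.restrict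
    have hl : ‖K.factor n‖ₑ ≤ 1 := by
      rw [Real.enorm_of_nonneg (by linarith [K.half_le n])]
      exact ENNReal.ofReal_le_one.2 (K.lt_one n).le
    simp only
    rw [eLpNorm_congr_ae hae]
    refine (eLpNorm_add_le (hm.const_smul _)
      (hg.aestronglyMeasurable.restrict.const_smul _) (by norm_num)).trans ?_
    rw [eLpNorm_const_smul, eLpNorm_const_smul]
    refine add_le_add ?_ (mul_le_mul' le_rfl (eLpNorm_mono_measure _ Measure.restrict_le_self))
    exact (mul_le_mul' hl le_rfl).trans_eq (one_mul _)

end PolytopalCell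

/-! ### Traces -/

namespace PolytopalCell

variable {d : ℕ} (T : PolytopalCell d)

/-- The height of the face is positive even from the apex moved by `ρ / 2` along the normal, which
stays in the open kernel ball. -/
theorem radius_half_le {i : Fin T.numFaces} {x : Space d} (hx : x ∈ T.face i)
    (h : (Measure.euclideanHausdorffMeasure (d - 1) : Measure (Space d)) (T.face i) ≠ 0) :
    T.radius / 2 ≤ inner ℝ (T.normal i) (x - T.center) := by
  obtain ⟨b, hb, hne⟩ := T.exists_mem_face_only h
  have hy : T.center + (T.radius / 2) • T.normal i ∈ T.kernelBall := by
    rw [kernelBall, mem_ball_iff_norm, add_sub_cancel_left, norm_smul, T.norm_normal i,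
      Real.norm_of_nonneg (by linarith [T.radius_pos])]
    linarith [T.radius_pos]
  have := T.inner_normal_pos hb hne hy
  rw [← T.inner_normal_face i _ hx hb, sub_add_eq_sub_sub, inner_sub_right, inner_smul_right,
    real_inner_self_eq_norm_sq, T.norm_normal i] at this
  linarith

/-- The radial divergence identity for `h ^ 2` at the center: the boundary weight is at least `ρ /
2` on faces of positive measure, and Young's inequality bounds the interior term. -/
theorem sum_integral_sq_le (hd : 0 < d) : ∃ C : ℝ, 0 ≤ C ∧ ∀ h : Space d → ℝ, ContDiff ℝ 1 h →
    ∑ i, ∫ x, h x ^ 2 ∂(T.faceSurface i) ≤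
      C * ∫ x in T.carrier, (h x ^ 2 +
        ∑ j, fderiv ℝ h x (EuclideanSpace.single j 1) ^ 2) := by
  obtain ⟨R, hR⟩ := T.isBounded.subset_closedBall T.center
  have hρ := T.radius_pos
  -- One `d` comes from the divergence of `x - c`, the other from the `d` Young inequalities, where
  -- `R` bounds each coordinate of `x - c`.
  refine ⟨2 / T.radius * (2 * d + R ^ 2), by positivity, fun h hh => ?_⟩
  have hc : Continuous fun x => fderiv ℝ h x := hh.continuous_fderiv (by norm_num)
  have hch : Continuous h := hh.continuous
  have hsq : ContDiff ℝ 1 fun x => h x ^ 2 := hh.pow 2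
  have hcsq : Continuous fun x => fderiv ℝ (fun x => h x ^ 2) x :=
    hsq.continuous_fderiv (by norm_num)
  have key := T.integral_radial_divergence hd T.center_mem hsq
  have hleft : T.radius / 2 * ∑ i, ∫ x, h x ^ 2 ∂(T.faceSurface i) ≤
      ∑ i, ∫ x, inner ℝ (T.normal i) (x - T.center) * h x ^ 2 ∂(T.faceSurface i) := by
    rw [Finset.mul_sum]
    refine Finset.sum_le_sum fun i _ => ?_
    by_cases h0 : (Measure.euclideanHausdorffMeasure (d - 1) : Measure (Space d)) (T.face i) = 0
    · simp [faceSurface, Measure.restrict_eq_zero.2 h0]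
    · rw [← integral_const_mul]
      refine integral_mono_ae (Continuous.integrable_faceSurface T (by fun_prop) i)
        (Continuous.integrable_faceSurface T (by fun_prop) i) ?_
      refine (ae_restrict_iff' (T.measurableSet_face i)).2 (Eventually.of_forall fun x hx => ?_)
      exact mul_le_mul_of_nonneg_right (T.radius_half_le hx h0) (sq_nonneg _)
  have hright : ∫ x in T.carrier, (d * h x ^ 2 +
        fderiv ℝ (fun x => h x ^ 2) x (x - T.center)) ≤
      (2 * d + R ^ 2) * ∫ x in T.carrier, (h x ^ 2 +
        ∑ j, fderiv ℝ h x (EuclideanSpace.single j 1) ^ 2) := by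
    rw [← integral_const_mul]
    refine setIntegral_mono_on (Continuous.integrableOn_of_isBounded (by fun_prop) T.isBounded)
      (Continuous.integrableOn_of_isBounded (by fun_prop) T.isBounded) T.measurableSet_carrier
      fun x hx => ?_
    have hfd : fderiv ℝ (fun x => h x ^ 2) x = (2 * h x) • fderiv ℝ h x := by
      have := ((hh.differentiable (by norm_num) x).hasFDerivAt.pow 2).fderiv
      simpa using this
    have hdec : x - T.center = ∑ j, (x - T.center) j • (EuclideanSpace.single j 1 : Space d) := by
      have := (EuclideanSpace.basisFun (Fin d) ℝ).sum_repr (x - T.center)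
      simpa using this.symm
    have hcoord : ∀ j, (x - T.center) j ^ 2 ≤ R ^ 2 := fun j => by
      have h1 := hR hx
      rw [mem_closedBall_iff_norm] at h1
      have h2 := (PiLp.norm_apply_le (x - T.center) j).trans h1
      rw [← sq_abs]
      exact pow_le_pow_left₀ (abs_nonneg _) h2 2
    have hsum : fderiv ℝ h x (x - T.center) = ∑ j, (x - T.center) j *
        fderiv ℝ h x (EuclideanSpace.single j 1) := by
      conv_lhs => rw [hdec]
      simp [map_sum]
    rw [hfd]
    simp only [_root_.smul_apply, smul_eq_mul, hsum]
    have hterm : 2 * h x * ∑ j, (x - T.center) j * fderiv ℝ h x (EuclideanSpace.single j 1) ≤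
        ∑ j, (h x ^ 2 + R ^ 2 * fderiv ℝ h x (EuclideanSpace.single j 1) ^ 2) := by
      rw [Finset.mul_sum]
      refine Finset.sum_le_sum fun j _ => ?_
      have h1 := mul_le_mul_of_nonneg_right (hcoord j)
        (sq_nonneg (fderiv ℝ h x (EuclideanSpace.single j 1)))
      nlinarith [sq_nonneg (h x - (x - T.center) j * fderiv ℝ h x (EuclideanSpace.single j 1))]
    rw [Finset.sum_add_distrib, ← Finset.mul_sum, Finset.sum_const, Finset.card_univ,
      Fintype.card_fin, nsmul_eq_mul] at hterm
    have h3 : 0 ≤ ∑ j, fderiv ℝ h x (EuclideanSpace.single j 1) ^ 2 :=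
      Finset.sum_nonneg fun j _ => sq_nonneg _
    have h4 : (0 : ℝ) ≤ d := d.cast_nonneg
    nlinarith [mul_nonneg h4 h3, mul_nonneg (sq_nonneg R) (sq_nonneg (h x))]
  rw [key] at hright
  have := hleft.trans hright
  rw [mul_assoc, div_mul_eq_mul_div, le_div_iff₀ hρ]
  linarith

theorem eLpNorm_two_sq_eq_ofReal {μ : Measure (Space d)} {f : Space d → ℝ}
    (hf : Integrable (fun x => f x ^ 2) μ) :
    eLpNorm f 2 μ ^ 2 = ENNReal.ofReal (∫ x, f x ^ 2 ∂μ) := by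
  rw [eLpNorm_two_sq, ofReal_integral_eq_lintegral_ofReal hf
    (Eventually.of_forall fun x => sq_nonneg _)]
  refine lintegral_congr fun x => ?_
  rw [← sq_abs, ENNReal.ofReal_pow (abs_nonneg _), ← Real.norm_eq_abs, ofReal_norm]

theorem eLpNorm_surface_le_sum {F : Type*} [NormedAddCommGroup F] (f : Space d → F) :
    eLpNorm f 2 T.surface ^ 2 ≤ ∑ i, eLpNorm f 2 (T.faceSurface i) ^ 2 := by
  simp only [eLpNorm_two_sq]
  rw [surface, ← T.iUnion_face]
  refine (lintegral_iUnion_le _ _).trans_eq ?_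
  rw [tsum_fintype]
  rfl

theorem faceSurface_le (i : Fin T.numFaces) : T.faceSurface i ≤ T.surface :=
  Measure.restrict_mono (T.face_subset i) le_rfl

/-- The trace inequality for smooth scalar functions. -/
theorem eLpNorm_surface_le (hd : 0 < d) : ∃ C : NNReal, ∀ h : Space d → ℝ, ContDiff ℝ 1 h →
    eLpNorm h 2 T.surface ≤ C * (eLpNorm h 2 (volume.restrict T.carrier) +
      ∑ j, eLpNorm (fun x => fderiv ℝ h x (EuclideanSpace.single j 1)) 2
        (volume.restrict T.carrier)) := by
  obtain ⟨C, hC, hle⟩ := T.sum_integral_sq_le hd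
  refine ⟨Real.toNNReal (√C), fun h hh => ?_⟩
  have hc : Continuous fun x => fderiv ℝ h x := hh.continuous_fderiv (by norm_num)
  have hch : Continuous h := hh.continuous
  have hint0 : Integrable (fun x => h x ^ 2) (volume.restrict T.carrier) :=
    Continuous.integrableOn_of_isBounded (by fun_prop) T.isBounded
  have hintj : ∀ j, Integrable (fun x => fderiv ℝ h x (EuclideanSpace.single j 1) ^ 2)
      (volume.restrict T.carrier) := fun j =>
    Continuous.integrableOn_of_isBounded (by fun_prop) T.isBounded
  rw [← pow_two_le_pow_two_iff]
  set a := eLpNorm h 2 (volume.restrict T.carrier) with ha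
  set b : Fin d → ENNReal := fun j =>
    eLpNorm (fun x => fderiv ℝ h x (EuclideanSpace.single j 1)) 2 (volume.restrict T.carrier)
  calc eLpNorm h 2 T.surface ^ 2 ≤ ∑ i, eLpNorm h 2 (T.faceSurface i) ^ 2 :=
        T.eLpNorm_surface_le_sum h
    _ = ENNReal.ofReal (∑ i, ∫ x, h x ^ 2 ∂(T.faceSurface i)) := by
        rw [ENNReal.ofReal_sum_of_nonneg fun i _ => integral_nonneg fun x => sq_nonneg _]
        exact Finset.sum_congr rfl fun i _ => eLpNorm_two_sq_eq_ofReal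
          (Continuous.integrable_faceSurface T (by fun_prop) i)
    _ ≤ ENNReal.ofReal (C * ∫ x in T.carrier, (h x ^ 2 +
        ∑ j, fderiv ℝ h x (EuclideanSpace.single j 1) ^ 2)) := ENNReal.ofReal_le_ofReal (hle h hh)
    _ = ENNReal.ofReal C * (a ^ 2 + ∑ j, b j ^ 2) := by
        rw [ENNReal.ofReal_mul hC, integral_add hint0 (integrable_finsetSum _ fun j _ => hintj j),
          integral_finsetSum _ fun j _ => hintj j,
          ENNReal.ofReal_add (integral_nonneg fun x => sq_nonneg _)
            (Finset.sum_nonneg fun j _ => integral_nonneg fun x => sq_nonneg _),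
          ENNReal.ofReal_sum_of_nonneg fun i _ => integral_nonneg fun x => sq_nonneg _,
          ha, eLpNorm_two_sq_eq_ofReal hint0]
        congr 2
        exact Finset.sum_congr rfl fun j _ => (eLpNorm_two_sq_eq_ofReal (hintj j)).symm
    _ ≤ ENNReal.ofReal C * (a + ∑ j, b j) ^ 2 := by
        refine mul_le_mul' le_rfl ?_
        have h1 : ∑ j, b j ^ 2 ≤ (∑ j, b j) ^ 2 := by
          rw [pow_two (∑ j, b j), Finset.sum_mul]
          refine Finset.sum_le_sum fun j hj => ?_
          rw [pow_two]
          exact mul_le_mul' le_rfl (Finset.single_le_sum (f := b) (fun _ _ => zero_le) hj)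
        calc a ^ 2 + ∑ j, b j ^ 2 ≤ a ^ 2 + (∑ j, b j) ^ 2 := by gcongr
          _ ≤ a ^ 2 + (∑ j, b j) ^ 2 + 2 * a * ∑ j, b j := le_self_add
          _ = _ := by ring
    _ = _ := by
        rw [mul_pow]
        congr 1
        rw [← ENNReal.ofReal, ← ENNReal.ofReal_pow (Real.sqrt_nonneg _), Real.sq_sqrt hC]

theorem eLpNorm_le_sum_coord {μ : Measure (Space d)} {f : Space d → Space d}
    (hf : AEStronglyMeasurable f μ) :
    eLpNorm f 2 μ ≤ ∑ i, eLpNorm (fun x => f x i) 2 μ := by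
  have hfi : ∀ i, AEStronglyMeasurable (fun x => ‖f x i‖) μ := fun i =>
    ((EuclideanSpace.proj i : Space d →L[ℝ] ℝ).continuous.comp_aestronglyMeasurable hf).norm
  calc eLpNorm f 2 μ ≤ eLpNorm (∑ i, fun x => ‖f x i‖) 2 μ := by
        refine eLpNorm_mono fun x => ?_
        rw [Finset.sum_apply, Real.norm_of_nonneg (Finset.sum_nonneg fun i _ => norm_nonneg _)]
        have h := (EuclideanSpace.basisFun (Fin d) ℝ).sum_repr (f x)
        conv_lhs => rw [← h]
        refine (norm_sum_le _ _).trans (Finset.sum_le_sum fun i _ => ?_)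
        simp [norm_smul]
    _ ≤ ∑ i, eLpNorm (fun x => ‖f x i‖) 2 μ := eLpNorm_sum_le (fun i _ => hfi i) (by norm_num)
    _ = _ := Finset.sum_congr rfl fun i _ => eLpNorm_norm fun x => f x i

/-- The trace inequality for smooth fields. -/
theorem eLpNorm_surface_le_field (hd : 0 < d) : ∃ C : NNReal, ∀ u : Space d → Space d,
    ContDiff ℝ 1 u → eLpNorm u 2 T.surface ≤ C * (eLpNorm u 2 (volume.restrict T.carrier) +
      ∑ i, ∑ j, eLpNorm (fun x => fderiv ℝ u x (EuclideanSpace.single j 1) i) 2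
        (volume.restrict T.carrier)) := by
  obtain ⟨C, hC⟩ := T.eLpNorm_surface_le hd
  -- The norm of `u` occurs once for each of the `d` coordinates, the derivative sum only once.
  refine ⟨C * (d + 1), fun u hu => ?_⟩
  have hcoord : ∀ i, ContDiff ℝ 1 fun x => u x i := fun i =>
    (EuclideanSpace.proj i : Space d →L[ℝ] ℝ).contDiff.comp hu
  have hder : ∀ i x e, fderiv ℝ (fun x => u x i) x e = fderiv ℝ u x e i := by
    intro i x e
    have h1 := (EuclideanSpace.proj i : Space d →L[ℝ] ℝ).hasFDerivAt.comp x
      (hu.differentiable (by norm_num) x).hasFDerivAt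
    have h2 : fderiv ℝ (fun x => u x i) x = _ := h1.fderiv
    rw [h2]; rfl
  have hle : ∀ i, eLpNorm (fun x => u x i) 2 (volume.restrict T.carrier) ≤
      eLpNorm u 2 (volume.restrict T.carrier) := fun i =>
    eLpNorm_mono fun x => PiLp.norm_apply_le (u x) i
  refine (eLpNorm_le_sum_coord hu.continuous.aestronglyMeasurable).trans ?_
  refine (Finset.sum_le_sum fun i _ => hC _ (hcoord i)).trans ?_
  simp only [hder]
  rw [← Finset.mul_sum, Finset.sum_add_distrib]
  push_cast
  rw [mul_assoc]
  refine mul_le_mul' le_rfl ?_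
  rw [mul_add]
  refine add_le_add ?_ ?_
  · refine (Finset.sum_le_sum fun i _ => hle i).trans ?_
    rw [Finset.sum_const, Finset.card_univ, Fintype.card_fin, nsmul_eq_mul]
    exact mul_le_mul' le_self_add le_rfl
  · rw [add_mul, one_mul]
    exact le_add_self

end PolytopalCell

/-! ### Limits in `L²`, existence of traces and Green's formula -/

theorem tendsto_integral_mul_of_eLpNorm {α : Type*} [MeasurableSpace α] {μ : Measure α}
    {f : ℕ → α → ℝ} {f₀ r : α → ℝ} (hf : ∀ n, MemLp (f n) 2 μ) (hf₀ : MemLp f₀ 2 μ)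
    (hr : MemLp r 2 μ) (h : Tendsto (fun n => eLpNorm (fun x => f n x - f₀ x) 2 μ) atTop (𝓝 0)) :
    Tendsto (fun n => ∫ x, f n x * r x ∂μ) atTop (𝓝 (∫ x, f₀ x * r x ∂μ)) := by
  refine tendsto_integral_of_L1' _ (hf₀.integrable_mul hr).aestronglyMeasurable
    (Eventually.of_forall fun n => (hf n).integrable_mul hr) ?_
  have hb : Tendsto (fun n => eLpNorm (fun x => f n x - f₀ x) 2 μ * eLpNorm r 2 μ) atTop (𝓝 0) := by
    simpa using ENNReal.Tendsto.mul_const h (Or.inr hr.eLpNorm_ne_top)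
  refine tendsto_of_tendsto_of_tendsto_of_le_of_le tendsto_const_nhds hb (fun n => zero_le)
    fun n => ?_
  have := eLpNorm_smul_le_mul_eLpNorm (p := 2) (q := 2) (r := 1) hr.aestronglyMeasurable
    ((hf n).sub hf₀).aestronglyMeasurable
  refine le_trans (le_of_eq ?_) this
  congr 1
  ext x
  simp only [Pi.sub_apply, Pi.mul_apply, Pi.smul_apply', smul_eq_mul]
  ring

theorem _root_.MeasureTheory.MemLp.coord {d : ℕ} {μ : Measure (Space d)} {f : Space d → Space d}
    (hf : MemLp f 2 μ) (i : Fin d) : MemLp (fun x => f x i) 2 μ :=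
  (EuclideanSpace.proj i : Space d →L[ℝ] ℝ).comp_memLp' hf

theorem tendsto_eLpNorm_coord {d : ℕ} {μ : Measure (Space d)} {u : ℕ → Space d → Space d}
    {g : Space d → Space d} (h : Tendsto (fun n => eLpNorm (fun x => u n x - g x) 2 μ) atTop (𝓝 0))
    (i : Fin d) : Tendsto (fun n => eLpNorm (fun x => u n x i - g x i) 2 μ) atTop (𝓝 0) :=
  tendsto_of_tendsto_of_tendsto_of_le_of_le tendsto_const_nhds h (fun _ => zero_le)
    fun n => eLpNorm_mono fun x => PiLp.norm_apply_le (u n x - g x) i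

namespace PolytopalCell

variable {d : ℕ} (T : PolytopalCell d)

theorem _root_.Continuous.memLp_carrier {F : Type*} [NormedAddCommGroup F] {f : Space d → F}
    (hf : Continuous f) (p : ENNReal) : MemLp f p (volume.restrict T.carrier) := by
  obtain ⟨C, hC⟩ := T.isBounded.isCompact_closure.exists_bound_of_continuousOn hf.continuousOn
  exact MemLp.of_bound hf.aestronglyMeasurable C ((ae_restrict_iff' T.measurableSet_carrier).2
    (Eventually.of_forall fun x hx => hC x (subset_closure hx)))

theorem _root_.Continuous.memLp_surface {F : Type*} [NormedAddCommGroup F] {f : Space d → F}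
    (hf : Continuous f) (p : ENNReal) : MemLp f p T.surface := by
  obtain ⟨C, hC⟩ := T.isBounded.isCompact_closure.exists_bound_of_continuousOn hf.continuousOn
  exact MemLp.of_bound hf.aestronglyMeasurable C
    ((ae_restrict_iff' isClosed_frontier.measurableSet).2
      (Eventually.of_forall fun x hx => hC x (frontier_subset_closure hx)))

/-- Every `H¹` field has a trace. -/
theorem exists_isTrace (hd : 0 < d) (v : H1 T) : ∃ g, IsTrace T v g := by
  obtain ⟨u, hu, hu0, hu1⟩ := T.exists_smooth_tendsto v
  obtain ⟨C, hC⟩ := T.eLpNorm_surface_le_field hd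
  have hu' : ∀ n, ContDiff ℝ 1 (u n) := fun n => (hu n).of_le (by simp)
  have hmem : ∀ n, MemLp (u n) 2 T.surface := fun n =>
    Continuous.memLp_surface T (hu n).continuous 2
  have hder : ∀ n i j, Continuous fun x => fderiv ℝ (u n) x (EuclideanSpace.single j 1) i := by
    intro n i j
    have := (hu' n).continuous_fderiv (by norm_num)
    fun_prop
  let a : ℕ → ENNReal := fun n =>
    eLpNorm (fun x => u n x - v.toFun x) 2 (volume.restrict T.carrier)
  let b : Fin d → Fin d → ℕ → ENNReal := fun i j n => eLpNorm
    (fun x => fderiv ℝ (u n) x (EuclideanSpace.single j 1) i - v.grad x i j) 2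
      (volume.restrict T.carrier)
  -- The trace inequality for differences makes the boundary values Cauchy in `L²` of the surface;
  -- their limit is the trace.
  have hle : ∀ n : ℕ × ℕ, eLpNorm (u n.1 - u n.2) 2 T.surface ≤
      C * ((a n.1 + a n.2) + ∑ i, ∑ j, (b i j n.1 + b i j n.2)) := by
    intro n
    refine (hC _ ((hu' n.1).sub (hu' n.2))).trans (mul_le_mul' le_rfl (add_le_add ?_
      (Finset.sum_le_sum fun i _ => Finset.sum_le_sum fun j _ => ?_)))
    · have h1 : (fun x => u n.1 x - u n.2 x) =
          (fun x => u n.1 x - v.toFun x) - fun x => u n.2 x - v.toFun x := by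
        ext x; simp
      have h2 : ∀ m, AEStronglyMeasurable (fun x => u m x - v.toFun x)
          (volume.restrict T.carrier) := fun m =>
        (hu m).continuous.aestronglyMeasurable.sub v.memLp.aestronglyMeasurable
      refine le_trans (le_of_eq (by rw [← h1])) (eLpNorm_sub_le (h2 _) (h2 _) (by norm_num))
    · have h1 : (fun x => fderiv ℝ (u n.1 - u n.2) x (EuclideanSpace.single j 1) i) =
          (fun x => fderiv ℝ (u n.1) x (EuclideanSpace.single j 1) i - v.grad x i j) -
          fun x => fderiv ℝ (u n.2) x (EuclideanSpace.single j 1) i - v.grad x i j := by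
        ext x
        rw [fderiv_sub ((hu' n.1).differentiable (by norm_num) x)
          ((hu' n.2).differentiable (by norm_num) x)]
        simp
      have h2 : ∀ m, AEStronglyMeasurable (fun x =>
          fderiv ℝ (u m) x (EuclideanSpace.single j 1) i - v.grad x i j)
          (volume.restrict T.carrier) := fun m =>
        (hder m i j).aestronglyMeasurable.sub (v.memLp_grad i j).aestronglyMeasurable
      refine le_trans (le_of_eq (by rw [← h1]; rfl)) (eLpNorm_sub_le (h2 _) (h2 _) (by norm_num))
  have hpair : ∀ {s : ℕ → ENNReal}, Tendsto s atTop (𝓝 0) →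
      Tendsto (fun n : ℕ × ℕ => s n.1 + s n.2) atTop (𝓝 0) := by
    intro s hs
    rw [← prod_atTop_atTop_eq]
    simpa using (hs.comp tendsto_fst).add (hs.comp tendsto_snd)
  have hlim : Tendsto (fun n : ℕ × ℕ => eLpNorm (u n.1 - u n.2) 2 T.surface) atTop (𝓝 0) := by
    have h1 : Tendsto (fun n : ℕ × ℕ => C * ((a n.1 + a n.2) +
        ∑ i, ∑ j, (b i j n.1 + b i j n.2))) atTop (𝓝 0) := by
      have h2 : Tendsto (fun n : ℕ × ℕ => ∑ i, ∑ j, (b i j n.1 + b i j n.2)) atTop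
          (𝓝 (∑ _i : Fin d, ∑ _j : Fin d, 0)) :=
        tendsto_finsetSum _ fun i _ => tendsto_finsetSum _ fun j _ => hpair (hu1 i j)
      have h3 := ENNReal.Tendsto.const_mul (a := (C : ENNReal)) ((hpair hu0).add h2)
        (Or.inr ENNReal.coe_ne_top)
      simpa using h3
    exact tendsto_of_tendsto_of_tendsto_of_le_of_le tendsto_const_nhds h1 (fun n => zero_le) hle
  have hcauchy : CauchySeq fun n => (hmem n).toLp (u n) := by
    rw [Lp.cauchySeq_Lp_iff_cauchySeq_eLpNorm]
    refine hlim.congr fun n => eLpNorm_congr_ae ?_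
    filter_upwards [(hmem n.1).coeFn_toLp, (hmem n.2).coeFn_toLp] with x h1 h2
    simp [h1, h2]
  obtain ⟨g, hg⟩ := cauchySeq_tendsto_of_complete hcauchy
  refine ⟨g, Lp.memLp g, u, hu, hu0, hu1, ?_⟩
  have := (Lp.tendsto_Lp_iff_tendsto_eLpNorm'' u hmem g (Lp.memLp g)).1 (by simpa using hg)
  exact this

theorem isTrace_trace (hd : 0 < d) (v : H1 T) : IsTrace T v (trace T v) :=
  Classical.epsilon_spec (T.exists_isTrace hd v)

/-- Green's formula for an `H¹` field and a smooth function. -/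
theorem integral_grad_mul_add (hd : 0 < d) {v : H1 T} {g : Space d → Space d} (hg : IsTrace T v g)
    {r : Space d → ℝ} (hr : ContDiff ℝ ∞ r) (i j : Fin d) :
    (∫ x in T.carrier, v.grad x i j * r x) +
      ∫ x in T.carrier, v.toFun x i * fderiv ℝ r x (EuclideanSpace.single j 1) =
      ∑ s, ∫ x, g x i * (r x * T.normal s j) ∂(T.faceSurface s) := by
  obtain ⟨hg2, u, hu, hu0, hu1, hug⟩ := hg
  have hu' : ∀ n, ContDiff ℝ 1 (u n) := fun n => (hu n).of_le (by simp)
  have hr' : ContDiff ℝ 1 r := hr.of_le (by simp)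
  have hrd : Continuous fun x => fderiv ℝ r x (EuclideanSpace.single j 1) := by
    have := hr'.continuous_fderiv (by norm_num)
    fun_prop
  have hder : ∀ n, Continuous fun x => fderiv ℝ (u n) x (EuclideanSpace.single j 1) i := by
    intro n
    have := (hu' n).continuous_fderiv (by norm_num)
    fun_prop
  have huc : ∀ n, Continuous fun x => u n x i := fun n => by
    have := (hu n).continuous
    fun_prop
  -- The divergence theorem for the product of the `i`-th component and `r`, in direction `j`. Every
  -- term passes to the limit.
  have hsmooth : ∀ n, (∫ x in T.carrier, fderiv ℝ (u n) x (EuclideanSpace.single j 1) i * r x) +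
      ∫ x in T.carrier, u n x i * fderiv ℝ r x (EuclideanSpace.single j 1) =
      ∑ s, ∫ x, u n x i * (r x * T.normal s j) ∂(T.faceSurface s) := by
    intro n
    have hui : ContDiff ℝ 1 fun x => u n x i :=
      (EuclideanSpace.proj i : Space d →L[ℝ] ℝ).contDiff.comp (hu' n)
    have h1 := T.integral_fderiv_eq hd (hui.mul hr') (EuclideanSpace.single j 1)
    have h0 := integral_add ((Continuous.memLp_carrier T (hder n) 2).integrable_mul
      (Continuous.memLp_carrier T hr.continuous 2))
      ((Continuous.memLp_carrier T (huc n) 2).integrable_mul (Continuous.memLp_carrier T hrd 2))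
    refine h0.symm.trans ?_
    convert h1 using 2
    · ext x
      have h2 := (EuclideanSpace.proj i : Space d →L[ℝ] ℝ).hasFDerivAt.comp x
        ((hu' n).differentiable (by norm_num) x).hasFDerivAt
      have h3 : HasFDerivAt (fun x => u n x i) _ x := h2
      have h4 : fderiv ℝ (fun x => u n x i * r x) x = _ :=
        (h3.mul (hr'.differentiable (by norm_num) x).hasFDerivAt).fderiv
      rw [h4]
      simp
      ring
    · rename_i s _
      congr 1
      ext x
      simp [EuclideanSpace.inner_single_right]
      ring
  have l1 := tendsto_integral_mul_of_eLpNorm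
    (fun n => Continuous.memLp_carrier T (hder n) 2) (v.memLp_grad i j)
    (Continuous.memLp_carrier T hr.continuous 2) (hu1 i j)
  have l2 := tendsto_integral_mul_of_eLpNorm
    (fun n => Continuous.memLp_carrier T (huc n) 2) (v.memLp.coord i)
    (Continuous.memLp_carrier T hrd 2) (tendsto_eLpNorm_coord hu0 i)
  have l3 : Tendsto (fun n => ∑ s, ∫ x, u n x i * (r x * T.normal s j) ∂(T.faceSurface s)) atTop
      (𝓝 (∑ s, ∫ x, g x i * (r x * T.normal s j) ∂(T.faceSurface s))) := by
    refine tendsto_finsetSum _ fun s _ => ?_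
    refine tendsto_integral_mul_of_eLpNorm
      (fun n => (Continuous.memLp_surface T (huc n) 2).mono_measure (T.faceSurface_le s))
      ((hg2.coord i).mono_measure (T.faceSurface_le s))
      ((Continuous.memLp_surface T (hr.continuous.mul continuous_const) 2).mono_measure
        (T.faceSurface_le s)) ?_
    exact tendsto_of_tendsto_of_tendsto_of_le_of_le tendsto_const_nhds
      (tendsto_eLpNorm_coord hug i) (fun n => zero_le)
      fun n => eLpNorm_mono_measure _ (T.faceSurface_le s)
  exact tendsto_nhds_unique ((l1.add l2).congr hsmooth) l3

end PolytopalCell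

/-! ### Vector-valued polynomials -/

open MvPolynomial in
theorem totalDegree_pderiv_le {σ R : Type*} [CommSemiring R] {p : MvPolynomial σ R} {l : ℕ}
    (hp : p.totalDegree ≤ l + 1) (i : σ) : (pderiv i p).totalDegree ≤ l := by
  refine Finset.sup_le fun m hm => ?_
  rw [mem_support_iff, coeff_pderiv] at hm
  have h1 := (le_totalDegree (mem_support_iff.2 (left_ne_zero_of_mul hm))).trans hp
  rw [Finsupp.sum_add_index' (fun _ => rfl) (fun _ _ _ => rfl), Finsupp.sum_single_index rfl] at h1
  omega

open MvPolynomial in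
-- The commutator of two derivations is a derivation, and this one vanishes on the variables.
theorem pderiv_comm {σ R : Type*} [CommRing R] (i j : σ) (p : MvPolynomial σ R) :
    pderiv i (pderiv j p) = pderiv j (pderiv i p) := by
  classical
  have h : ⁅(pderiv i : Derivation R (MvPolynomial σ R) (MvPolynomial σ R)),
      (pderiv j : Derivation R (MvPolynomial σ R) (MvPolynomial σ R))⁆ = 0 := by
    refine derivation_ext fun k => ?_
    rw [Derivation.commutator_apply, pderiv_X, pderiv_X]
    by_cases h1 : k = i <;> by_cases h2 : k = j <;> simp [h1, h2, Pi.single_apply] <;>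
      split_ifs <;> simp
  have := DFunLike.congr_fun h p
  rwa [Derivation.commutator_apply, Derivation.zero_apply, sub_eq_zero] at this

open MvPolynomial in
-- A coefficient at `m` with `m i ≠ 0` reappears in the `i`-th derivative multiplied by `m i`, which
-- is nonzero in characteristic zero.
theorem eq_C_of_pderiv_eq_zero {σ R : Type*} [CommRing R] [IsDomain R] [CharZero R]
    {p : MvPolynomial σ R} (h : ∀ i, pderiv i p = 0) : p = C (coeff 0 p) := by
  classical
  ext m
  rw [coeff_C]
  split_ifs with hm
  · rw [hm]
  · obtain ⟨i, hi⟩ : ∃ i, m i ≠ 0 := by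
      by_contra! hcon
      exact hm (Finsupp.ext fun i => (hcon i).symm)
    have h1 := coeff_pderiv (i := i) p (m - Finsupp.single i 1)
    rw [h i, coeff_zero, tsub_add_cancel_of_le
      (Finsupp.single_le_iff.2 (Nat.one_le_iff_ne_zero.2 hi))] at h1
    rcases mul_eq_zero.1 h1.symm with h2 | h2
    · exact h2
    · exact absurd h2 (Nat.cast_add_one_ne_zero _)

/-- Korn's identity: the second derivatives of a field with zero strain vanish. -/
theorem pderiv_pderiv_eq_zero {σ : Type*} {p : σ → MvPolynomial σ ℝ}
    (h : ∀ i j, MvPolynomial.pderiv j (p i) + MvPolynomial.pderiv i (p j) = 0) (i j k : σ) :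
    MvPolynomial.pderiv k (MvPolynomial.pderiv j (p i)) = 0 := by
  have h' : ∀ a b, MvPolynomial.pderiv b (p a) = - MvPolynomial.pderiv a (p b) := fun a b =>
    eq_neg_of_add_eq_zero_left (h a b)
  -- Swapping component and derivative costs a sign, commuting derivatives does not; three swaps
  -- cycle back to the start with sign `-1`.
  have e : MvPolynomial.pderiv k (MvPolynomial.pderiv j (p i)) =
      - MvPolynomial.pderiv k (MvPolynomial.pderiv j (p i)) := by
    calc MvPolynomial.pderiv k (MvPolynomial.pderiv j (p i))
        = - MvPolynomial.pderiv k (MvPolynomial.pderiv i (p j)) := by rw [h' i j, map_neg]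
      _ = - MvPolynomial.pderiv i (MvPolynomial.pderiv k (p j)) := by rw [pderiv_comm]
      _ = MvPolynomial.pderiv i (MvPolynomial.pderiv j (p k)) := by rw [h' j k, map_neg, neg_neg]
      _ = MvPolynomial.pderiv j (MvPolynomial.pderiv i (p k)) := by rw [pderiv_comm]
      _ = - MvPolynomial.pderiv j (MvPolynomial.pderiv k (p i)) := by rw [h' k i, map_neg]
      _ = _ := by rw [pderiv_comm]
  exact self_eq_neg.1 e

/-- The function on `Space d` defined by a polynomial. -/
def evalPoly {d : ℕ} (p : MvPolynomial (Fin d) ℝ) (x : Space d) : ℝ :=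
  MvPolynomial.eval (fun j => x j) p

theorem evalPoly_C {d : ℕ} (a : ℝ) :
    evalPoly (MvPolynomial.C a : MvPolynomial (Fin d) ℝ) = fun _ => a := by
  ext x; simp [evalPoly]

theorem evalPoly_add {d : ℕ} (p q : MvPolynomial (Fin d) ℝ) :
    evalPoly (p + q) = fun x => evalPoly p x + evalPoly q x := by
  ext x; simp [evalPoly]

theorem evalPoly_mul_X {d : ℕ} (p : MvPolynomial (Fin d) ℝ) (i : Fin d) :
    evalPoly (p * MvPolynomial.X i) = fun x => evalPoly p x * x i := by
  ext x; simp [evalPoly]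

theorem contDiff_evalPoly {d : ℕ} (p : MvPolynomial (Fin d) ℝ) : ContDiff ℝ ∞ (evalPoly p) := by
  induction p using MvPolynomial.induction_on with
  | C a => rw [evalPoly_C]; exact contDiff_const
  | add p q hp hq => rw [evalPoly_add]; exact hp.add hq
  | mul_X p i hp =>
    rw [evalPoly_mul_X]
    exact hp.mul (EuclideanSpace.proj i : Space d →L[ℝ] ℝ).contDiff

theorem continuous_evalPoly {d : ℕ} (p : MvPolynomial (Fin d) ℝ) : Continuous (evalPoly p) :=
  (contDiff_evalPoly p).continuous

theorem fderiv_evalPoly {d : ℕ} (p : MvPolynomial (Fin d) ℝ) (x : Space d) (j : Fin d) :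
    fderiv ℝ (evalPoly p) x (EuclideanSpace.single j 1) = evalPoly (MvPolynomial.pderiv j p) x := by
  have hdiff : ∀ p : MvPolynomial (Fin d) ℝ, DifferentiableAt ℝ (evalPoly p) x := fun p =>
    (contDiff_evalPoly p).differentiable (by simp) x
  induction p using MvPolynomial.induction_on with
  | C a => simp [evalPoly_C, evalPoly]
  | add p q hp hq =>
    rw [evalPoly_add, map_add, evalPoly_add, fderiv_fun_add (hdiff p) (hdiff q)]
    simp [hp, hq]
  | mul_X p i hp =>
    have hi : HasFDerivAt (fun y : Space d => y i) (EuclideanSpace.proj i : Space d →L[ℝ] ℝ) x :=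
      (EuclideanSpace.proj i : Space d →L[ℝ] ℝ).hasFDerivAt
    have h : fderiv ℝ (fun x => evalPoly p x * x i) x = _ := ((hdiff p).hasFDerivAt.mul hi).fderiv
    rw [evalPoly_mul_X, h]
    simp only [_root_.add_apply, _root_.smul_apply, hp, smul_eq_mul, MvPolynomial.pderiv_mul,
      MvPolynomial.pderiv_X]
    by_cases hij : i = j
    · subst hij; simp [evalPoly]; ring
    · simp [evalPoly, hij]; ring

/-- An open set contains a box, that is, a product of infinite sets of reals. -/
theorem eq_zero_of_evalPoly_eq_zero {d : ℕ} {U : Set (Space d)} (hU : IsOpen U) (hne : U.Nonempty)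
    {p : MvPolynomial (Fin d) ℝ} (h : ∀ x ∈ U, evalPoly p x = 0) : p = 0 := by
  obtain ⟨x, hx⟩ := hne
  have hopen : IsOpen ((WithLp.toLp 2 : (Fin d → ℝ) → Space d) ⁻¹' U) :=
    hU.preimage (PiLp.continuous_toLp 2 _)
  obtain ⟨ε, hε, hball⟩ := Metric.isOpen_iff.1 hopen (fun j => x j) hx
  refine MvPolynomial.funext_set (fun j => Metric.ball (x j) ε) (fun j => ?_) fun y hy => ?_
  · rw [Real.ball_eq_Ioo]
    exact Ioo_infinite (by linarith)
  · rw [← ball_pi _ hε] at hy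
    rw [map_zero]
    exact h _ (hball hy)

variable {d : ℕ}

theorem mem_vecPoly {l : ℕ} {p : Fin d → MvPolynomial (Fin d) ℝ} :
    p ∈ vecPoly d l ↔ ∀ i, (p i).totalDegree ≤ l := by
  simp [vecPoly, Submodule.mem_pi, MvPolynomial.mem_restrictTotalDegree]

instance (l : ℕ) : Module.Finite ℝ (vecPoly d l) := by
  let f : vecPoly d l →ₗ[ℝ] (Fin d → MvPolynomial.restrictTotalDegree (Fin d) ℝ l) :=
    LinearMap.pi fun i => ((LinearMap.proj i).comp (vecPoly d l).subtype).codRestrict _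
      fun p => (Submodule.mem_pi.1 p.2) i (mem_univ i)
  refine Module.Finite.of_injective f fun p q h => ?_
  ext1
  funext i
  exact congrArg Subtype.val (congrFun h i)

theorem evalVec_apply (p : Fin d → MvPolynomial (Fin d) ℝ) (x : Space d) (i : Fin d) :
    evalVec p x i = evalPoly (p i) x := rfl

theorem continuous_evalVec (p : Fin d → MvPolynomial (Fin d) ℝ) : Continuous (evalVec p) :=
  (PiLp.continuous_toLp 2 _).comp (continuous_pi fun i => continuous_evalPoly (p i))

theorem evalVec_add (p q : Fin d → MvPolynomial (Fin d) ℝ) (x : Space d) :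
    evalVec (p + q) x = evalVec p x + evalVec q x := by
  ext i; simp [evalVec]

theorem evalVec_smul (c : ℝ) (p : Fin d → MvPolynomial (Fin d) ℝ) (x : Space d) :
    evalVec (c • p) x = c • evalVec p x := by
  ext i; simp [evalVec, MvPolynomial.smul_eval]

theorem polyGrad_apply (p : Fin d → MvPolynomial (Fin d) ℝ) (x : Space d) (i j : Fin d) :
    polyGrad p x i j = evalPoly (MvPolynomial.pderiv j (p i)) x := rfl

theorem polyGrad_add (p q : Fin d → MvPolynomial (Fin d) ℝ) (x : Space d) :
    polyGrad (p + q) x = polyGrad p x + polyGrad q x := by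
  ext i j; simp [polyGrad]

theorem polyGrad_smul (c : ℝ) (p : Fin d → MvPolynomial (Fin d) ℝ) (x : Space d) :
    polyGrad (c • p) x = c • polyGrad p x := by
  ext i j; simp [polyGrad, MvPolynomial.smul_eval]

/-- The strain of a vector-valued polynomial, as a matrix of polynomials. -/
def strainPoly : (Fin d → MvPolynomial (Fin d) ℝ) →ₗ[ℝ]
    (Fin d → Fin d → MvPolynomial (Fin d) ℝ) where
  toFun p i j := MvPolynomial.C (2⁻¹ : ℝ) *
    (MvPolynomial.pderiv j (p i) + MvPolynomial.pderiv i (p j))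
  map_add' p q := by
    ext1 i; ext1 j
    simp only [Pi.add_apply, map_add]
    ring
  map_smul' c p := by
    ext1 i; ext1 j
    simp only [Pi.smul_apply, Derivation.map_smul, RingHom.id_apply, ← smul_add, mul_smul_comm]

theorem polyStrain_apply (p : Fin d → MvPolynomial (Fin d) ℝ) (x : Space d) (i j : Fin d) :
    polyStrain p x i j = evalPoly (strainPoly p i j) x := by
  simp [polyStrain, symPart, polyGrad, evalPoly, strainPoly]

theorem strainPoly_symm (p : Fin d → MvPolynomial (Fin d) ℝ) (i j : Fin d) :
    strainPoly p i j = strainPoly p j i := by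
  simp only [strainPoly, LinearMap.coe_mk, AddHom.coe_mk]
  rw [add_comm]

theorem strainPoly_eq_zero_iff {p : Fin d → MvPolynomial (Fin d) ℝ} : strainPoly p = 0 ↔
    ∀ i j, MvPolynomial.pderiv j (p i) + MvPolynomial.pderiv i (p j) = 0 := by
  constructor
  · intro h i j
    have := congrFun (congrFun h i) j
    simpa [strainPoly] using this
  · intro h
    ext1 i; ext1 j
    simp [strainPoly, h i j]

theorem polyDivStrain_eq (p : Fin d → MvPolynomial (Fin d) ℝ) (i : Fin d) :
    polyDivStrain p i = ∑ j, MvPolynomial.pderiv j (strainPoly p i j) := rfl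

/-- The row-wise divergence of the strain, as a linear map. -/
def divStrain : (Fin d → MvPolynomial (Fin d) ℝ) →ₗ[ℝ] (Fin d → MvPolynomial (Fin d) ℝ) where
  toFun := polyDivStrain
  map_add' p q := by
    ext1 i
    simp [polyDivStrain_eq, Finset.sum_add_distrib]
  map_smul' c p := by
    ext1 i
    simp [polyDivStrain_eq, Finset.smul_sum]

/-- The strain applied to a fixed vector. -/
def strainVec (n : Space d) :
    (Fin d → MvPolynomial (Fin d) ℝ) →ₗ[ℝ] (Fin d → MvPolynomial (Fin d) ℝ) where
  toFun p i := ∑ j, n j • strainPoly p i j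
  map_add' p q := by
    ext1 i
    simp [Finset.sum_add_distrib]
  map_smul' c p := by
    ext1 i
    simp only [map_smul, Pi.smul_apply, RingHom.id_apply, Finset.smul_sum]
    exact Finset.sum_congr rfl fun j _ => smul_comm _ _ _

theorem evalVec_strainVec (n : Space d) (p : Fin d → MvPolynomial (Fin d) ℝ) (x : Space d) :
    evalVec (strainVec n p) x = matVec (polyStrain p x) n := by
  ext i
  simp [evalVec, strainVec, matVec, Matrix.mulVec, dotProduct, polyStrain_apply, evalPoly,
    MvPolynomial.smul_eval, mul_comm]

theorem totalDegree_strainPoly_le {l : ℕ} {p : Fin d → MvPolynomial (Fin d) ℝ}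
    (hp : p ∈ vecPoly d (l + 1)) (i j : Fin d) : (strainPoly p i j).totalDegree ≤ l := by
  refine (MvPolynomial.totalDegree_mul _ _).trans ?_
  rw [MvPolynomial.totalDegree_C, zero_add]
  exact (MvPolynomial.totalDegree_add _ _).trans
    (max_le (totalDegree_pderiv_le (mem_vecPoly.1 hp i) j)
      (totalDegree_pderiv_le (mem_vecPoly.1 hp j) i))

theorem strainVec_mem {l : ℕ} {p : Fin d → MvPolynomial (Fin d) ℝ} (hp : p ∈ vecPoly d (l + 1))
    (n : Space d) : strainVec n p ∈ vecPoly d l :=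
  mem_vecPoly.2 fun i => MvPolynomial.totalDegree_finsetSum_le fun j _ =>
    (MvPolynomial.totalDegree_smul_le _ _).trans (totalDegree_strainPoly_le hp i j)

/-- Not sharp, but this and `strainVec_mem` are all that is needed for the test fields to lie in the
ranges of the projections. -/
theorem divStrain_mem {l : ℕ} {p : Fin d → MvPolynomial (Fin d) ℝ} (hp : p ∈ vecPoly d (l + 1)) :
    divStrain p ∈ vecPoly d l :=
  mem_vecPoly.2 fun i => MvPolynomial.totalDegree_finsetSum_le fun j _ =>
    totalDegree_pderiv_le ((totalDegree_strainPoly_le hp i j).trans (Nat.le_succ l)) j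

variable {d : ℕ}

/-! ### Linear functionals on polynomials -/

/-- A symmetric bilinear form on a finite-dimensional space represents every functional that
vanishes on its kernel. -/
theorem exists_forall_apply_eq {V : Type*} [AddCommGroup V] [Module ℝ V] [Module.Finite ℝ V]
    (B : V →ₗ[ℝ] V →ₗ[ℝ] ℝ) (hB : ∀ p q, B p q = B q p) (l : V →ₗ[ℝ] ℝ)
    (hl : ∀ q, B q q = 0 → l q = 0) : ∃ p, ∀ q, B p q = l q := by
  -- The range of the dual map is the annihilator of `ker B`; reflexivity and symmetry then turn a
  -- preimage in the bidual into a vector of `V`.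
  have hmem : l ∈ LinearMap.range (LinearMap.dualMap (B : V →ₗ[ℝ] Module.Dual ℝ V)) := by
    rw [LinearMap.range_dualMap_eq_dualAnnihilator_ker, Submodule.mem_dualAnnihilator]
    intro q hq
    exact hl q (by rw [LinearMap.mem_ker.1 hq]; rfl)
  obtain ⟨Φ, hΦ⟩ := hmem
  obtain ⟨p, rfl⟩ := (Module.evalEquiv ℝ V).surjective Φ
  refine ⟨p, fun q => ?_⟩
  rw [← hΦ, hB]
  rfl

theorem integrable_inner_of_memLp {α : Type*} [MeasurableSpace α] {μ : Measure α}
    {f g : α → Space d} (hf : MemLp f 2 μ) (hg : MemLp g 2 μ) :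
    Integrable (fun x => inner ℝ (f x) (g x)) μ := by
  have h : ∀ x, inner ℝ (f x) (g x) = ∑ i, f x i * g x i := fun x => by
    simp [PiLp.inner_apply, mul_comm]
  simp only [h]
  have hc : ∀ {f : α → Space d}, MemLp f 2 μ → ∀ i, MemLp (fun x => f x i) 2 μ := fun hf i =>
    (EuclideanSpace.proj i : Space d →L[ℝ] ℝ).comp_memLp' hf
  exact integrable_finsetSum _ fun i _ => (hc hf i).integrable_mul (hc hg i)

/-- The functional `p ↦ ∫ g · ev p` for a family `ev` of square-integrable fields. -/
def innerFunctional {α V : Type*} [MeasurableSpace α] (μ : Measure α) [AddCommGroup V] [Module ℝ V]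
    (ev : V →ₗ[ℝ] (α → Space d)) (hev : ∀ p, MemLp (ev p) 2 μ) (g : α → Space d)
    (hg : MemLp g 2 μ) : V →ₗ[ℝ] ℝ where
  toFun p := ∫ x, inner ℝ (g x) (ev p x) ∂μ
  map_add' p q := by
    rw [← integral_add (integrable_inner_of_memLp hg (hev p))
      (integrable_inner_of_memLp hg (hev q))]
    simp [inner_add_right]
  map_smul' c p := by
    simp [inner_smul_right, integral_const_mul]

/-- The `L²`-projection onto a finite-dimensional space of fields exists. -/
theorem exists_projection {α V : Type*} [MeasurableSpace α] {μ : Measure α} [AddCommGroup V]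
    [Module ℝ V] [Module.Finite ℝ V] (ev : V →ₗ[ℝ] (α → Space d)) (hev : ∀ p, MemLp (ev p) 2 μ)
    {g : α → Space d} (hg : MemLp g 2 μ) :
    ∃ p, ∀ q, ∫ x, inner ℝ (ev p x - g x) (ev q x) ∂μ = 0 := by
  let B : V →ₗ[ℝ] V →ₗ[ℝ] ℝ := LinearMap.mk₂ ℝ (fun p q => ∫ x, inner ℝ (ev p x) (ev q x) ∂μ)
    (fun p p' q => by
      rw [← integral_add (integrable_inner_of_memLp (hev p) (hev q))
        (integrable_inner_of_memLp (hev p') (hev q))]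
      simp [inner_add_left])
    (fun c p q => by simp [inner_smul_left, integral_const_mul])
    (fun p q q' => (innerFunctional μ ev hev (ev p) (hev p)).map_add q q')
    (fun c p q => (innerFunctional μ ev hev (ev p) (hev p)).map_smul c q)
  obtain ⟨p, hp⟩ := exists_forall_apply_eq B (fun p q => by
      simp only [B]
      exact integral_congr_ae (Eventually.of_forall fun x => real_inner_comm _ _))
    -- `B q q = 0` forces `ev q = 0` only almost everywhere, which is enough. No injectivity of `ev`
    -- is needed, so faces of zero measure are allowed.
    (innerFunctional μ ev hev g hg) (fun q hq => by
      have h1 : ∫ x, inner ℝ (ev q x) (ev q x) ∂μ = 0 := hq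
      rw [integral_eq_zero_iff_of_nonneg (fun x => real_inner_self_nonneg)
        (integrable_inner_of_memLp (hev q) (hev q))] at h1
      refine integral_eq_zero_of_ae ?_
      filter_upwards [h1] with x hx
      rw [inner_self_eq_zero.1 hx, inner_zero_right]
      rfl)
  refine ⟨p, fun q => ?_⟩
  have h1 : ∫ x, inner ℝ (ev p x) (ev q x) ∂μ = ∫ x, inner ℝ (g x) (ev q x) ∂μ := hp q
  simp only [inner_sub_left]
  rw [integral_sub (integrable_inner_of_memLp (hev p) (hev q))
    (integrable_inner_of_memLp hg (hev q)), h1, sub_self]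

/-! ### Algebra of the Frobenius product and of the strain -/

theorem frob_comm (A B : Matrix (Fin d) (Fin d) ℝ) : frob A B = frob B A := by
  simp [frob, mul_comm]

theorem frob_add_right (A B C : Matrix (Fin d) (Fin d) ℝ) :
    frob A (B + C) = frob A B + frob A C := by
  simp [frob, mul_add, Finset.sum_add_distrib]

theorem frob_smul_right (c : ℝ) (A B : Matrix (Fin d) (Fin d) ℝ) :
    frob A (c • B) = c * frob A B := by
  simp [frob, Finset.mul_sum, mul_left_comm]

theorem frob_sub_left (A B C : Matrix (Fin d) (Fin d) ℝ) :
    frob (A - B) C = frob A C - frob B C := by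
  simp [frob, sub_mul, Finset.sum_sub_distrib]

theorem symPart_add (A B : Matrix (Fin d) (Fin d) ℝ) :
    symPart (A + B) = symPart A + symPart B := by
  simp only [symPart, Matrix.transpose_add, ← smul_add]
  abel_nf

theorem symPart_smul (c : ℝ) (A : Matrix (Fin d) (Fin d) ℝ) :
    symPart (c • A) = c • symPart A := by
  simp only [symPart, Matrix.transpose_smul, ← smul_add]
  exact smul_comm _ _ _

theorem polyStrain_add (p q : Fin d → MvPolynomial (Fin d) ℝ) (x : Space d) :
    polyStrain (p + q) x = polyStrain p x + polyStrain q x := by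
  rw [polyStrain, polyGrad_add, symPart_add]; rfl

theorem polyStrain_smul (c : ℝ) (p : Fin d → MvPolynomial (Fin d) ℝ) (x : Space d) :
    polyStrain (c • p) x = c • polyStrain p x := by
  rw [polyStrain, polyGrad_smul, symPart_smul]; rfl

theorem continuous_polyStrain (p : Fin d → MvPolynomial (Fin d) ℝ) (i j : Fin d) :
    Continuous fun x => polyStrain p x i j := by
  simp only [polyStrain_apply]
  exact continuous_evalPoly _

/-! ### The strain energy, its kernel and the traction problem -/

namespace PolytopalCell

variable (T : PolytopalCell d)

theorem integrable_frob {A B : Space d → Matrix (Fin d) (Fin d) ℝ}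
    (hA : ∀ i j, MemLp (fun x => A x i j) 2 (volume.restrict T.carrier))
    (hB : ∀ i j, MemLp (fun x => B x i j) 2 (volume.restrict T.carrier)) :
    Integrable (fun x => frob (A x) (B x)) (volume.restrict T.carrier) :=
  integrable_finsetSum _ fun i _ => integrable_finsetSum _ fun j _ =>
    (hA i j).integrable_mul (hB i j)

theorem memLp_polyStrain (p : Fin d → MvPolynomial (Fin d) ℝ) (i j : Fin d) :
    MemLp (fun x => polyStrain p x i j) 2 (volume.restrict T.carrier) :=
  Continuous.memLp_carrier T (continuous_polyStrain p i j) 2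

/-- The functional `q ↦ ∫ A : ε(q)`. -/
def strainFunctional (A : Space d → Matrix (Fin d) (Fin d) ℝ)
    (hA : ∀ i j, MemLp (fun x => A x i j) 2 (volume.restrict T.carrier)) :
    (Fin d → MvPolynomial (Fin d) ℝ) →ₗ[ℝ] ℝ where
  toFun q := ∫ x in T.carrier, frob (A x) (polyStrain q x)
  map_add' p q := by
    rw [← integral_add (T.integrable_frob hA (T.memLp_polyStrain p))
      (T.integrable_frob hA (T.memLp_polyStrain q))]
    simp only [polyStrain_add, frob_add_right]
  map_smul' c p := by
    simp only [polyStrain_smul, frob_smul_right, integral_const_mul]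
    rfl

/-- The strain energy `(p, q) ↦ ∫ ε(p) : ε(q)`. -/
def energy : (Fin d → MvPolynomial (Fin d) ℝ) →ₗ[ℝ] (Fin d → MvPolynomial (Fin d) ℝ) →ₗ[ℝ] ℝ :=
  LinearMap.mk₂ ℝ (fun p q => ∫ x in T.carrier, frob (polyStrain p x) (polyStrain q x))
    (fun p p' q => by
      simp only [frob_comm _ (polyStrain q _)]
      exact (T.strainFunctional (polyStrain q) (T.memLp_polyStrain q)).map_add p p')
    (fun c p q => by
      simp only [frob_comm _ (polyStrain q _)]
      exact (T.strainFunctional (polyStrain q) (T.memLp_polyStrain q)).map_smul c p)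
    (fun p q q' => (T.strainFunctional (polyStrain p) (T.memLp_polyStrain p)).map_add q q')
    (fun c p q => (T.strainFunctional (polyStrain p) (T.memLp_polyStrain p)).map_smul c q)

theorem energy_apply (p q : Fin d → MvPolynomial (Fin d) ℝ) :
    T.energy p q = ∫ x in T.carrier, frob (polyStrain p x) (polyStrain q x) := rfl

theorem energy_comm (p q : Fin d → MvPolynomial (Fin d) ℝ) : T.energy p q = T.energy q p := by
  simp only [energy_apply, frob_comm]

theorem nonempty_carrier : T.carrier.Nonempty := ⟨_, T.kernelBall_subset T.center_mem⟩

theorem volume_real_pos : 0 < volume.real T.carrier := by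
  rw [Measure.real, ENNReal.toReal_pos_iff]
  exact ⟨T.isOpen.measure_pos _ T.nonempty_carrier, T.isBounded.measure_lt_top⟩

/-- The integrand is a continuous sum of squares with zero integral, so every strain entry vanishes
on the open cell, hence as a polynomial. -/
theorem strainPoly_eq_zero {p : Fin d → MvPolynomial (Fin d) ℝ} (h : T.energy p p = 0) :
    strainPoly p = 0 := by
  have hnn : ∀ x, 0 ≤ frob (polyStrain p x) (polyStrain p x) := fun x =>
    Finset.sum_nonneg fun i _ => Finset.sum_nonneg fun j _ => mul_self_nonneg _
  have hcont : Continuous fun x => frob (polyStrain p x) (polyStrain p x) :=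
    continuous_finsetSum _ fun i _ => continuous_finsetSum _ fun j _ =>
      (continuous_polyStrain p i j).mul (continuous_polyStrain p i j)
  rw [energy_apply, integral_eq_zero_iff_of_nonneg hnn
    (T.integrable_frob (T.memLp_polyStrain p) (T.memLp_polyStrain p))] at h
  have hon := Measure.eqOn_open_of_ae_eq h T.isOpen hcont.continuousOn continuousOn_const
  ext1 i; ext1 j
  refine eq_zero_of_evalPoly_eq_zero T.isOpen T.nonempty_carrier fun x hx => ?_
  have h1 : frob (polyStrain p x) (polyStrain p x) = 0 := hon hx
  have h2 := (Finset.sum_eq_zero_iff_of_nonneg fun i _ =>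
    Finset.sum_nonneg fun j _ => mul_self_nonneg _).1 h1 i (Finset.mem_univ i)
  have h3 := (Finset.sum_eq_zero_iff_of_nonneg fun j _ => mul_self_nonneg _).1 h2 j
    (Finset.mem_univ j)
  rw [← polyStrain_apply]
  exact mul_self_eq_zero.1 h3

theorem energy_eq_zero {p : Fin d → MvPolynomial (Fin d) ℝ} (h : strainPoly p = 0)
    (q : Fin d → MvPolynomial (Fin d) ℝ) : T.energy p q = 0 := by
  rw [energy_apply]
  simp [frob, polyStrain_apply, h, evalPoly]

theorem meanVec_apply {v : Space d → Space d}
    (hv : Integrable v (volume.restrict T.carrier)) (i : Fin d) :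
    meanVec T.carrier v i = ⨍ x in T.carrier, v x i := by
  rw [meanVec, setAverage_eq, setAverage_eq, PiLp.smul_apply]
  congr 1
  exact ((EuclideanSpace.proj i : Space d →L[ℝ] ℝ).integral_comp_comm hv).symm

theorem integrable_evalVec (p : Fin d → MvPolynomial (Fin d) ℝ) :
    Integrable (evalVec p) (volume.restrict T.carrier) :=
  (continuous_evalVec p).integrableOn_of_isBounded T.isBounded

theorem integrable_polyGrad (p : Fin d → MvPolynomial (Fin d) ℝ) (i j : Fin d) :
    Integrable (fun x => polyGrad p x i j) (volume.restrict T.carrier) :=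
  (continuous_evalPoly _).integrableOn_of_isBounded T.isBounded

theorem meanVec_add {v w : Space d → Space d} (hv : Integrable v (volume.restrict T.carrier))
    (hw : Integrable w (volume.restrict T.carrier)) :
    meanVec T.carrier (fun x => v x + w x) = meanVec T.carrier v + meanVec T.carrier w := by
  simp only [meanVec, setAverage_eq]
  rw [integral_add hv hw, smul_add]

theorem meanVec_sub {v w : Space d → Space d} (hv : Integrable v (volume.restrict T.carrier))
    (hw : Integrable w (volume.restrict T.carrier)) :
    meanVec T.carrier (fun x => v x - w x) = meanVec T.carrier v - meanVec T.carrier w := by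
  simp only [meanVec, setAverage_eq]
  rw [integral_sub hv hw, smul_sub]

theorem average_const (c : ℝ) : ⨍ _x in T.carrier, c = c := by
  rw [setAverage_eq, setIntegral_const, smul_smul, inv_mul_cancel₀ T.volume_real_pos.ne', one_smul]

theorem meanVec_const (c : Space d) : meanVec T.carrier (fun _ => c) = c := by
  rw [meanVec, setAverage_eq, setIntegral_const, smul_smul,
    inv_mul_cancel₀ T.volume_real_pos.ne', one_smul]

theorem meanMat_skewPart {M : Space d → Matrix (Fin d) (Fin d) ℝ}
    (hM : ∀ i j, Integrable (fun x => M x i j) (volume.restrict T.carrier)) :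
    meanMat T.carrier (fun x => skewPart (M x)) = skewPart (meanMat T.carrier M) := by
  ext i j
  simp only [meanMat, skewPart, Matrix.of_apply, Matrix.smul_apply, Matrix.sub_apply,
    Matrix.transpose_apply, smul_eq_mul, setAverage_eq]
  rw [integral_const_mul, integral_sub (hM i j) (hM j i)]
  ring

theorem meanMat_add {M N : Space d → Matrix (Fin d) (Fin d) ℝ}
    (hM : ∀ i j, Integrable (fun x => M x i j) (volume.restrict T.carrier))
    (hN : ∀ i j, Integrable (fun x => N x i j) (volume.restrict T.carrier)) :
    meanMat T.carrier (fun x => M x + N x) = meanMat T.carrier M + meanMat T.carrier N := by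
  ext i j
  simp only [meanMat, Matrix.of_apply, Matrix.add_apply, smul_eq_mul, setAverage_eq]
  rw [integral_add (hM i j) (hN i j)]
  ring

theorem meanMat_sub {M N : Space d → Matrix (Fin d) (Fin d) ℝ}
    (hM : ∀ i j, Integrable (fun x => M x i j) (volume.restrict T.carrier))
    (hN : ∀ i j, Integrable (fun x => N x i j) (volume.restrict T.carrier)) :
    meanMat T.carrier (fun x => M x - N x) = meanMat T.carrier M - meanMat T.carrier N := by
  ext i j
  simp only [meanMat, Matrix.of_apply, Matrix.sub_apply, smul_eq_mul, setAverage_eq]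
  rw [integral_sub (hM i j) (hN i j)]
  ring

/-- The mean skew-symmetric gradient of a polynomial. -/
theorem meanMat_skew_polyGrad (p : Fin d → MvPolynomial (Fin d) ℝ) :
    meanMat T.carrier (fun x => skewPart (polyGrad p x)) =
      skewPart (meanMat T.carrier (polyGrad p)) :=
  T.meanMat_skewPart (T.integrable_polyGrad p)

theorem skewPart_add (A B : Matrix (Fin d) (Fin d) ℝ) :
    skewPart (A + B) = skewPart A + skewPart B := by
  simp only [skewPart, Matrix.transpose_add, ← smul_add]
  congr 1; abel

theorem skewPart_sub (A B : Matrix (Fin d) (Fin d) ℝ) :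
    skewPart (A - B) = skewPart A - skewPart B := by
  simp only [skewPart, Matrix.transpose_sub, ← smul_sub]
  congr 1; abel

/-- A field with zero strain, zero mean and zero mean skew-symmetric gradient vanishes. -/
theorem eq_zero_of_strainPoly_eq_zero {p : Fin d → MvPolynomial (Fin d) ℝ}
    (h : strainPoly p = 0) (hm : meanVec T.carrier (evalVec p) = 0)
    (hs : meanMat T.carrier (fun x => skewPart (polyGrad p x)) = 0) : p = 0 := by
  have hsym := strainPoly_eq_zero_iff.1 h
  -- The gradient is constant and skew, so it equals its mean skew part, which is zero; then `p` is
  -- constant and equals its mean.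
  have hconst : ∀ i j, MvPolynomial.pderiv j (p i) =
      MvPolynomial.C (MvPolynomial.coeff 0 (MvPolynomial.pderiv j (p i))) := fun i j =>
    eq_C_of_pderiv_eq_zero fun k => pderiv_pderiv_eq_zero hsym i j k
  have hgrad : ∀ i j, MvPolynomial.pderiv j (p i) = 0 := by
    intro i j
    set w := MvPolynomial.coeff 0 (MvPolynomial.pderiv j (p i)) with hw
    have hji : MvPolynomial.pderiv i (p j) = MvPolynomial.C (-w) := by
      rw [map_neg, hw, ← hconst i j]
      exact eq_neg_of_add_eq_zero_right (hsym i j)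
    have h1 := congrFun (congrFun hs i) j
    have h2 : ∀ x, skewPart (polyGrad p x) i j = w := by
      intro x
      simp only [skewPart, Matrix.smul_apply, Matrix.sub_apply, Matrix.transpose_apply,
        polyGrad_apply, smul_eq_mul]
      rw [hji, hconst i j, ← hw]
      simp only [evalPoly_C]
      ring
    simp only [meanMat, Matrix.of_apply, h2, Matrix.zero_apply, T.average_const] at h1
    rw [hconst i j, ← hw, h1, map_zero]
  ext1 i
  have hci := eq_C_of_pderiv_eq_zero (hgrad i)
  have h1 : meanVec T.carrier (evalVec p) i = 0 := by rw [hm]; rfl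
  rw [T.meanVec_apply (T.integrable_evalVec p)] at h1
  simp only [evalVec_apply] at h1
  rw [hci, evalPoly_C, T.average_const] at h1
  rw [hci, h1]
  simp

/-- There is a rigid-body motion with given mean and given mean skew-symmetric gradient. -/
theorem exists_rigid (l : ℕ) (c : Space d) {W : Matrix (Fin d) (Fin d) ℝ} (hW : W.transpose = -W) :
    ∃ r ∈ vecPoly d (l + 1), strainPoly r = 0 ∧ meanVec T.carrier (evalVec r) = c ∧
      meanMat T.carrier (fun x => skewPart (polyGrad r x)) = W := by
  let r₀ : Fin d → MvPolynomial (Fin d) ℝ := fun i =>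
    ∑ j, MvPolynomial.C (W i j) * MvPolynomial.X j
  -- The constant corrects the mean of the linear field `W x`, as the cell need not be centred at
  -- the origin.
  let c₀ : Space d := c - meanVec T.carrier (evalVec r₀)
  let r₁ : Fin d → MvPolynomial (Fin d) ℝ := fun i => MvPolynomial.C (c₀ i)
  have hder : ∀ i j, MvPolynomial.pderiv j ((r₀ + r₁) i) = MvPolynomial.C (W i j) := by
    intro i j
    simp [r₀, r₁, Pi.single_apply]
  have hWij : ∀ i j, W j i = - W i j := fun i j => congrFun (congrFun hW i) j
  refine ⟨r₀ + r₁, mem_vecPoly.2 fun i => ?_, strainPoly_eq_zero_iff.2 fun i j => ?_, ?_, ?_⟩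
  · refine (MvPolynomial.totalDegree_add _ _).trans (max_le ?_ ?_)
    · refine MvPolynomial.totalDegree_finsetSum_le fun j _ => ?_
      refine (MvPolynomial.totalDegree_mul _ _).trans ?_
      rw [MvPolynomial.totalDegree_C, MvPolynomial.totalDegree_X]
      omega
    · rw [MvPolynomial.totalDegree_C]
      omega
  · rw [hder, hder, hWij i j, map_neg, add_neg_cancel]
  · have h1 : evalVec (r₀ + r₁) = fun x => evalVec r₀ x + evalVec r₁ x :=
      funext fun x => evalVec_add r₀ r₁ x
    have h2 : evalVec r₁ = fun _ => c₀ := by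
      funext x; ext i; simp [evalVec, r₁]
    rw [h1, T.meanVec_add (T.integrable_evalVec _) (T.integrable_evalVec _), h2, T.meanVec_const]
    simp [c₀]
  · ext i j
    have h2 : ∀ x, skewPart (polyGrad (r₀ + r₁) x) i j = W i j := by
      intro x
      simp only [skewPart, Matrix.smul_apply, Matrix.sub_apply, Matrix.transpose_apply,
        polyGrad_apply, smul_eq_mul, hder, evalPoly_C]
      rw [hWij i j]
      ring
    simp only [meanMat, Matrix.of_apply, h2, T.average_const]

/-- Well-posedness of the discrete pure traction problem. -/
theorem existsUnique_traction (k : ℕ) (l : vecPoly d (k + 1) →ₗ[ℝ] ℝ)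
    (hl : ∀ q : vecPoly d (k + 1), strainPoly q.1 = 0 → l q = 0) (c : Space d)
    {W : Matrix (Fin d) (Fin d) ℝ} (hW : W.transpose = -W) :
    ∃! p : vecPoly d (k + 1), (∀ q (hq : q ∈ perpPoly T (k + 1)), T.energy p.1 q = l ⟨q, hq.1⟩) ∧
      meanVec T.carrier (evalVec p.1) = c ∧
      meanMat T.carrier (fun x => skewPart (polyGrad p.1 x)) = W := by
  have hint : ∀ (p : Fin d → MvPolynomial (Fin d) ℝ) (i j : Fin d),
      Integrable (fun x => skewPart (polyGrad p x) i j) (volume.restrict T.carrier) :=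
    fun p i j => ((T.integrable_polyGrad p i j).sub (T.integrable_polyGrad p j i)).const_mul 2⁻¹
  refine existsUnique_of_exists_of_unique ?_ ?_
  swap
  -- The difference has zero moments, so it may be used as a test field against itself.
  · rintro p p' ⟨hp1, hp2, hp3⟩ ⟨hp1', hp2', hp3'⟩
    have hev : evalVec (p.1 - p'.1) = fun x => evalVec p.1 x - evalVec p'.1 x := by
      funext x
      rw [sub_eq_add_neg, ← neg_one_smul ℝ p'.1, evalVec_add, evalVec_smul]
      module
    have hgr : ∀ x, polyGrad (p.1 - p'.1) x = polyGrad p.1 x - polyGrad p'.1 x := by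
      intro x
      rw [sub_eq_add_neg, ← neg_one_smul ℝ p'.1, polyGrad_add, polyGrad_smul]
      module
    have hm : meanVec T.carrier (evalVec (p.1 - p'.1)) = 0 := by
      rw [hev, T.meanVec_sub (T.integrable_evalVec _) (T.integrable_evalVec _), hp2, hp2', sub_self]
    have hs : meanMat T.carrier (fun x => skewPart (polyGrad (p.1 - p'.1) x)) = 0 := by
      simp only [hgr, skewPart_sub]
      rw [T.meanMat_sub (hint _) (hint _), hp3, hp3', sub_self]
    have hq : p.1 - p'.1 ∈ perpPoly T (k + 1) := ⟨sub_mem p.2 p'.2, hm, hs⟩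
    have he : T.energy (p.1 - p'.1) (p.1 - p'.1) = 0 := by
      rw [map_sub, T.energy_comm _ p.1, T.energy_comm _ p'.1, hp1 _ hq, hp1' _ hq, sub_self]
    exact Subtype.ext (sub_eq_zero.1
      (T.eq_zero_of_strainPoly_eq_zero (T.strainPoly_eq_zero he) hm hs))
  -- `p₀` solves the equation against all `q` of degree `k + 1`; the rigid motion `r` added below
  -- fixes the moments and has no energy.
  obtain ⟨p₀, hp₀⟩ := exists_forall_apply_eq
    (T.energy.domRestrict₁₂ (vecPoly d (k + 1)) (vecPoly d (k + 1)))
    (fun p q => T.energy_comm p.1 q.1) l (fun q hq => hl q (T.strainPoly_eq_zero hq))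
  have hskew : (meanMat T.carrier fun x => skewPart (polyGrad p₀.1 x)).transpose =
      -(meanMat T.carrier fun x => skewPart (polyGrad p₀.1 x)) := by
    rw [meanMat_skew_polyGrad]
    ext i j
    simp [skewPart]
    ring
  obtain ⟨r, hr, hr0, hrm, hrs⟩ := T.exists_rigid k (c - meanVec T.carrier (evalVec p₀.1))
    (W := W - meanMat T.carrier fun x => skewPart (polyGrad p₀.1 x))
    (by rw [Matrix.transpose_sub, hW, hskew]; abel)
  refine ⟨p₀ + ⟨r, hr⟩, fun q hq => ?_, ?_, ?_⟩
  · rw [Submodule.coe_add, map_add, LinearMap.add_apply, T.energy_eq_zero hr0, add_zero]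
    exact hp₀ ⟨q, hq.1⟩
  · have h1 : evalVec (p₀.1 + r) = fun x => evalVec p₀.1 x + evalVec r x :=
      funext fun x => evalVec_add p₀.1 r x
    rw [Submodule.coe_add, h1, T.meanVec_add (T.integrable_evalVec _) (T.integrable_evalVec _),
      hrm]
    abel
  · rw [Submodule.coe_add]
    simp only [polyGrad_add, skewPart_add]
    rw [T.meanMat_add (hint _) (hint _), hrs]
    abel

end PolytopalCell

namespace PolytopalCell

variable {d : ℕ} (T : PolytopalCell d)

/-! ### Projections -/

instance (F : Set (Space d)) (k : ℕ) : Module.Finite ℝ (facePoly F k) :=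
  Module.Finite.map (vecPoly d k) (restrictPoly F)

/-- Evaluation of vector-valued polynomials, as a linear map. -/
def evalField : (Fin d → MvPolynomial (Fin d) ℝ) →ₗ[ℝ] (Space d → Space d) where
  toFun := evalVec
  map_add' p q := funext fun x => evalVec_add p q x
  map_smul' c p := funext fun x => evalVec_smul c p x

theorem memLp_evalVec (p : Fin d → MvPolynomial (Fin d) ℝ) :
    MemLp (evalVec p) 2 (volume.restrict T.carrier) :=
  Continuous.memLp_carrier T (continuous_evalVec p) 2

theorem map_faceMeasure (s : Fin T.numFaces) :
    (faceMeasure (T.face s)).map Subtype.val = T.faceSurface s :=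
  map_comap_subtype_coe (T.measurableSet_face s) _

theorem integral_faceMeasure (s : Fin T.numFaces) (f : Space d → ℝ) :
    ∫ x : T.face s, f x ∂(faceMeasure (T.face s)) = ∫ x, f x ∂(T.faceSurface s) :=
  integral_subtype_comap (T.measurableSet_face s) f

theorem memLp_faceMeasure {s : Fin T.numFaces} {f : Space d → Space d}
    (hf : MemLp f 2 (T.faceSurface s)) :
    MemLp (fun x : T.face s => f x) 2 (faceMeasure (T.face s)) := by
  rw [← map_faceMeasure] at hf
  exact hf.comp_of_map measurable_subtype_coe.aemeasurable

theorem memLp_faceSurface_evalVec (s : Fin T.numFaces) (p : Fin d → MvPolynomial (Fin d) ℝ) :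
    MemLp (evalVec p) 2 (T.faceSurface s) :=
  (Continuous.memLp_surface T (continuous_evalVec p) 2).mono_measure (T.faceSurface_le s)

theorem memLp_restrictPoly (s : Fin T.numFaces) (p : Fin d → MvPolynomial (Fin d) ℝ) :
    MemLp (restrictPoly (T.face s) p) 2 (faceMeasure (T.face s)) :=
  T.memLp_faceMeasure (T.memLp_faceSurface_evalVec s p)

theorem memLp_facePoly {k : ℕ} {s : Fin T.numFaces} (w : facePoly (T.face s) k) :
    MemLp w.1 2 (faceMeasure (T.face s)) := by
  obtain ⟨p, -, hp⟩ := w.2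
  rw [← hp]
  exact T.memLp_restrictPoly s p

theorem integral_inner_cellProj (k : ℕ) {v : Space d → Space d}
    (hv : MemLp v 2 (volume.restrict T.carrier)) {q : Fin d → MvPolynomial (Fin d) ℝ}
    (hq : q ∈ vecPoly d k) :
    ∫ x in T.carrier, inner ℝ (evalVec (cellProj T k v).1 x) (evalVec q x) =
      ∫ x in T.carrier, inner ℝ (v x) (evalVec q x) := by
  have h := Classical.epsilon_spec (exists_projection
    (evalField.comp (vecPoly d k).subtype) (fun p => T.memLp_evalVec p.1) hv) ⟨q, hq⟩
  have h' : ∫ x in T.carrier, inner ℝ (evalVec (cellProj T k v).1 x - v x) (evalVec q x) = 0 := h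
  simp only [inner_sub_left] at h'
  rw [integral_sub (integrable_inner_of_memLp (T.memLp_evalVec _) (T.memLp_evalVec q))
    (integrable_inner_of_memLp hv (T.memLp_evalVec q))] at h'
  exact sub_eq_zero.1 h'

/-- Face unknowns are functions on the subtype, while the trace lives on the ambient space; this
removes the projection and passes from one setting to the other. -/
theorem integral_inner_faceProj (k : ℕ) {s : Fin T.numFaces} {g : Space d → Space d}
    (hg : MemLp g 2 (T.faceSurface s)) {q : Fin d → MvPolynomial (Fin d) ℝ}
    (hq : q ∈ vecPoly d k) :
    ∫ x : T.face s, inner ℝ ((faceProj (T.face s) k g).1 x) (evalVec q x)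
        ∂(faceMeasure (T.face s)) =
      ∫ x, inner ℝ (g x) (evalVec q x) ∂(T.faceSurface s) := by
  have h := Classical.epsilon_spec (exists_projection (facePoly (T.face s) k).subtype
    (fun w => T.memLp_facePoly w) (T.memLp_faceMeasure hg))
    ⟨restrictPoly (T.face s) q, Submodule.mem_map_of_mem hq⟩
  have h' : ∫ x : T.face s, inner ℝ ((faceProj (T.face s) k g).1 x - g x) (evalVec q x)
      ∂(faceMeasure (T.face s)) = 0 := h
  simp only [inner_sub_left] at h'
  have hi : Integrable (fun x : T.face s =>
      inner ℝ ((faceProj (T.face s) k g).1 x) (evalVec q x)) (faceMeasure (T.face s)) :=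
    integrable_inner_of_memLp (T.memLp_facePoly _) (T.memLp_restrictPoly s q)
  have hi' : Integrable (fun x : T.face s => inner ℝ (g x) (evalVec q x))
      (faceMeasure (T.face s)) :=
    integrable_inner_of_memLp (T.memLp_faceMeasure hg) (T.memLp_restrictPoly s q)
  rw [integral_sub hi hi'] at h'
  rw [sub_eq_zero.1 h']
  exact T.integral_faceMeasure s fun x => inner ℝ (g x) (evalVec q x)

/-! ### Well-posedness of the displacement reconstruction and of the elliptic projection -/

theorem skewTensor_apply (a b : Space d) (i j : Fin d) :
    skewTensor a b i j = 2⁻¹ * (a i * b j - a j * b i) := by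
  simp [skewTensor, skewPart]

/-- A traction problem: the right-hand side sees `q` only through its strain, and the prescribed
matrix is skew because `⊗ₛₛ` is antisymmetric. -/
theorem existsUnique_isDispRec (k : ℕ) (w : LocalSpace T k) : ∃! p, IsDispRec T k w p := by
  let l : vecPoly d (k + 1) →ₗ[ℝ] ℝ :=
    (-((innerFunctional (volume.restrict T.carrier) evalField T.memLp_evalVec (evalVec w.1.1)
        (T.memLp_evalVec w.1.1)).comp divStrain) +
      ∑ s, (innerFunctional (faceMeasure (T.face s)) (restrictPoly (T.face s))
        (T.memLp_restrictPoly s) (w.2 s).1 (T.memLp_facePoly (w.2 s))).comp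
          (strainVec (T.normal s))).comp (vecPoly d (k + 1)).subtype
  have hl : ∀ q : vecPoly d (k + 1), l q =
      - (∫ x in T.carrier, inner ℝ (evalVec w.1.1 x) (evalVec (polyDivStrain q.1) x)) +
        ∑ i, ∫ x : T.face i, inner ℝ ((w.2 i).1 x) (matVec (polyStrain q.1 x) (T.normal i))
          ∂(faceMeasure (T.face i)) := by
    intro q
    simp only [← evalVec_strainVec]
    simp only [l, LinearMap.comp_apply, LinearMap.add_apply, LinearMap.neg_apply,
      LinearMap.sum_apply]
    rfl
  have h0 : ∀ q : vecPoly d (k + 1), strainPoly q.1 = 0 → l q = 0 := by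
    intro q hq
    rw [hl]
    have h1 : ∀ x, evalVec (polyDivStrain q.1) x = 0 := by
      intro x; ext i
      simp [evalVec, polyDivStrain_eq, hq]
    have h2 : ∀ x n, matVec (polyStrain q.1 x) n = 0 := by
      intro x n; ext i
      simp [matVec, Matrix.mulVec, dotProduct, polyStrain_apply, hq, evalPoly]
    simp [h1, h2]
  have hW : (Matrix.of fun a b => (volume.real T.carrier)⁻¹ * ∑ i, ∫ x : T.face i,
      skewTensor ((w.2 i).1 x) (T.normal i) a b ∂(faceMeasure (T.face i))).transpose =
      -(Matrix.of fun a b => (volume.real T.carrier)⁻¹ * ∑ i, ∫ x : T.face i,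
      skewTensor ((w.2 i).1 x) (T.normal i) a b ∂(faceMeasure (T.face i))) := by
    ext a b
    simp only [Matrix.transpose_apply, Matrix.of_apply, Matrix.neg_apply]
    rw [← mul_neg, ← Finset.sum_neg_distrib]
    congr 1
    refine Finset.sum_congr rfl fun i _ => ?_
    rw [← integral_neg]
    congr 1
    funext x
    rw [skewTensor_apply, skewTensor_apply]
    ring
  refine (existsUnique_congr fun p => ?_).1 (T.existsUnique_traction k l h0
    (meanVec T.carrier (evalVec w.1.1)) hW)
  refine and_congr (forall_congr' fun q => ?_) Iff.rfl
  exact forall_congr' fun hq => by rw [hl]; rfl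

theorem memLp_symPart_grad (v : H1 T) (i j : Fin d) :
    MemLp (fun x => symPart (v.grad x) i j) 2 (volume.restrict T.carrier) :=
  ((v.memLp_grad i j).add (v.memLp_grad j i)).const_mul 2⁻¹

theorem integrable_field (v : H1 T) : Integrable v.toFun (volume.restrict T.carrier) :=
  v.memLp.integrable (by norm_num)

theorem integrable_grad (v : H1 T) (i j : Fin d) :
    Integrable (fun x => v.grad x i j) (volume.restrict T.carrier) :=
  (v.memLp_grad i j).integrable (by norm_num)

/-- Separates the unknown from the data, which gives the form of `existsUnique_traction`. -/
theorem isEllipticProj_iff (k : ℕ) (v : H1 T) (p : vecPoly d (k + 1)) :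
    IsEllipticProj T k v p ↔
      (∀ q ∈ perpPoly T (k + 1), T.energy p.1 q =
        ∫ x in T.carrier, frob (symPart (v.grad x)) (polyStrain q x)) ∧
      meanVec T.carrier (evalVec p.1) = meanVec T.carrier v.toFun ∧
      meanMat T.carrier (fun x => skewPart (polyGrad p.1 x)) =
        skewPart (meanMat T.carrier v.grad) := by
  refine and_congr (forall_congr' fun q => forall_congr' fun hq => ?_) (and_congr ?_ ?_)
  · simp only [frob_sub_left]
    rw [integral_sub (T.integrable_frob (T.memLp_polyStrain _) (T.memLp_polyStrain q))
      (T.integrable_frob (T.memLp_symPart_grad v) (T.memLp_polyStrain q)), sub_eq_zero]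
    rfl
  · rw [T.meanVec_sub (T.integrable_evalVec _) (T.integrable_field v), sub_eq_zero]
  · rw [T.meanMat_skew_polyGrad,
      T.meanMat_skewPart (M := fun x => polyGrad p.1 x - v.grad x) (fun i j => (T.integrable_polyGrad _ i j).sub (T.integrable_grad v i j)),
      T.meanMat_sub (T.integrable_polyGrad _) (T.integrable_grad v), skewPart_sub, sub_eq_zero]

theorem existsUnique_isEllipticProj (k : ℕ) (v : H1 T) : ∃! p, IsEllipticProj T k v p := by
  have h0 : ∀ q : vecPoly d (k + 1), strainPoly q.1 = 0 →
      ((T.strainFunctional (fun x => symPart (v.grad x)) (T.memLp_symPart_grad v)).comp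
        (vecPoly d (k + 1)).subtype) q = 0 := by
    intro q hq
    change ∫ x in T.carrier, frob (symPart (v.grad x)) (polyStrain q.1 x) = 0
    simp [frob, polyStrain_apply, hq, evalPoly]
  have hW : (skewPart (meanMat T.carrier v.grad)).transpose =
      -skewPart (meanMat T.carrier v.grad) := by
    ext i j
    simp [skewPart]
    ring
  exact (existsUnique_congr fun p => (T.isEllipticProj_iff k v p).symm).1
    (T.existsUnique_traction k _ h0 (meanVec T.carrier v.toFun) hW)

/-! ### The commutation property -/

theorem inner_eq_sum (a b : Space d) : inner ℝ a b = ∑ i, a i * b i := by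
  simp [PiLp.inner_apply, mul_comm]

/-- Skew matrices are orthogonal to symmetric ones, so the strain of `v` can be replaced by its full
gradient. -/
theorem frob_symPart {A E : Matrix (Fin d) (Fin d) ℝ} (hE : ∀ i j, E i j = E j i) :
    frob (symPart A) E = frob A E := by
  have h : ∑ i, ∑ j, A j i * E i j = ∑ i, ∑ j, A i j * E i j := by
    rw [Finset.sum_comm]
    exact Finset.sum_congr rfl fun i _ => Finset.sum_congr rfl fun j _ => by rw [hE]
  calc frob (symPart A) E = 2⁻¹ * (∑ i, ∑ j, A i j * E i j + ∑ i, ∑ j, A j i * E i j) := by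
        simp only [frob, symPart, Matrix.smul_apply, Matrix.add_apply, Matrix.transpose_apply,
          smul_eq_mul, ← Finset.sum_add_distrib, Finset.mul_sum]
        exact Finset.sum_congr rfl fun i _ => Finset.sum_congr rfl fun j _ => by ring
    _ = frob A E := by rw [h, frob]; ring

theorem integral_sum_sum {α : Type*} [MeasurableSpace α] {μ : Measure α}
    {F : Fin d → Fin d → α → ℝ} (hF : ∀ i j, Integrable (F i j) μ) :
    ∫ x, ∑ i, ∑ j, F i j x ∂μ = ∑ i, ∑ j, ∫ x, F i j x ∂μ := by
  rw [integral_finsetSum _ fun i _ => integrable_finsetSum _ fun j _ => hF i j]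
  exact Finset.sum_congr rfl fun i _ => integral_finsetSum _ fun j _ => hF i j

/-- Green's formula for the strain of an `H¹` field against the strain of a polynomial. -/
theorem integral_strain (hd : 0 < d) {v : H1 T} {g : Space d → Space d} (hg : IsTrace T v g)
    (q : Fin d → MvPolynomial (Fin d) ℝ) :
    ∫ x in T.carrier, frob (symPart (v.grad x)) (polyStrain q x) =
      - (∫ x in T.carrier, inner ℝ (v.toFun x) (evalVec (polyDivStrain q) x)) +
        ∑ s, ∫ x, inner ℝ (g x) (evalVec (strainVec (T.normal s) q) x) ∂(T.faceSurface s) := by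
  have hgs : ∀ s i, MemLp (fun x => g x i) 2 (T.faceSurface s) := fun s i =>
    (hg.1.coord i).mono_measure (T.faceSurface_le s)
  have hpc : ∀ r : MvPolynomial (Fin d) ℝ, MemLp (evalPoly r) 2 (volume.restrict T.carrier) :=
    fun r => Continuous.memLp_carrier T (continuous_evalPoly r) 2
  have hps : ∀ s (r : MvPolynomial (Fin d) ℝ), MemLp (evalPoly r) 2 (T.faceSurface s) :=
    fun s r => (Continuous.memLp_surface T (continuous_evalPoly r) 2).mono_measure
      (T.faceSurface_le s)
  have e1 : ∫ x in T.carrier, frob (symPart (v.grad x)) (polyStrain q x) =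
      ∑ i, ∑ j, ∫ x in T.carrier, v.grad x i j * evalPoly (strainPoly q i j) x := by
    have : ∀ x, frob (symPart (v.grad x)) (polyStrain q x) =
        ∑ i, ∑ j, v.grad x i j * evalPoly (strainPoly q i j) x := fun x => by
      rw [frob_symPart fun i j => by rw [polyStrain_apply, polyStrain_apply, strainPoly_symm]]
      simp only [frob, polyStrain_apply]
    simp only [this]
    exact integral_sum_sum fun i j => (v.memLp_grad i j).integrable_mul (hpc _)
  have e2 : ∫ x in T.carrier, inner ℝ (v.toFun x) (evalVec (polyDivStrain q) x) =
      ∑ i, ∑ j, ∫ x in T.carrier, v.toFun x i *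
        fderiv ℝ (evalPoly (strainPoly q i j)) x (EuclideanSpace.single j 1) := by
    have : ∀ x, inner ℝ (v.toFun x) (evalVec (polyDivStrain q) x) =
        ∑ i, ∑ j, v.toFun x i * evalPoly (MvPolynomial.pderiv j (strainPoly q i j)) x := fun x => by
      rw [inner_eq_sum]
      refine Finset.sum_congr rfl fun i _ => ?_
      rw [← Finset.mul_sum, evalVec_apply, polyDivStrain_eq, evalPoly, map_sum]
      rfl
    simp only [this, fderiv_evalPoly]
    exact integral_sum_sum fun i j => (v.memLp.coord i).integrable_mul (hpc _)
  have e3 : ∀ s, ∫ x, inner ℝ (g x) (evalVec (strainVec (T.normal s) q) x) ∂(T.faceSurface s) =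
      ∑ i, ∑ j, ∫ x, g x i * (evalPoly (strainPoly q i j) x * T.normal s j)
        ∂(T.faceSurface s) := by
    intro s
    have : ∀ x, inner ℝ (g x) (evalVec (strainVec (T.normal s) q) x) =
        ∑ i, ∑ j, g x i * (evalPoly (strainPoly q i j) x * T.normal s j) := fun x => by
      rw [inner_eq_sum]
      refine Finset.sum_congr rfl fun i _ => ?_
      rw [← Finset.mul_sum, evalVec_strainVec]
      simp [matVec, Matrix.mulVec, dotProduct, polyStrain_apply]
    simp only [this]
    exact integral_sum_sum fun i j =>
      (hgs s i).integrable_mul ((hps s (strainPoly q i j)).mul_const _)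
  -- Green's formula entry by entry, with the strain entries of `q` as smooth weights.
  have key := fun i j => T.integral_grad_mul_add hd hg (contDiff_evalPoly (strainPoly q i j)) i j
  rw [e1, e2, Finset.sum_congr rfl fun s _ => e3 s, eq_neg_add_iff_add_eq, add_comm,
    ← Finset.sum_add_distrib]
  simp only [← Finset.sum_add_distrib, key]
  exact (Finset.sum_congr rfl fun i _ => Finset.sum_comm).trans Finset.sum_comm

/-- Green's formula rewrites the data of the elliptic projection in terms of `v` and its trace.
Every test field that then occurs has degree at most `k`, so both may be replaced by their
projections. -/
theorem isDispRec_reduction (hd : 0 < d) (k : ℕ) (v : H1 T) {p : vecPoly d (k + 1)}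
    (hp : IsEllipticProj T k v p) : IsDispRec T k (reduction T k v) p := by
  have htr := T.isTrace_trace hd v
  have hgs : ∀ s, MemLp (trace T v) 2 (T.faceSurface s) := fun s =>
    htr.1.mono_measure (T.faceSurface_le s)
  obtain ⟨h1, h2, h3⟩ := (T.isEllipticProj_iff k v p).1 hp
  have hconst : ∀ c : Space d, (fun i => MvPolynomial.C (c i)) ∈ vecPoly d k := fun c =>
    mem_vecPoly.2 fun i => by rw [MvPolynomial.totalDegree_C]; exact Nat.zero_le k
  have hconst_eval : ∀ (c x : Space d), evalVec (fun i => MvPolynomial.C (c i)) x = c := by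
    intro c x; ext i; simp [evalVec]
  refine ⟨fun q hq => ?_, ?_, ?_⟩
  · rw [← energy_apply, h1 q hq, T.integral_strain hd htr q]
    congr 1
    · rw [neg_inj]
      exact (T.integral_inner_cellProj k v.memLp (divStrain_mem hq.1)).symm
    · refine Finset.sum_congr rfl fun s _ => ?_
      simp only [← evalVec_strainVec]
      exact (T.integral_inner_faceProj k (hgs s) (strainVec_mem hq.1 _)).symm
  · rw [h2]
    -- Constants are admissible tests for the cell projection, so it preserves the mean.
    refine ext_inner_right ℝ fun c => ?_
    have h4 := T.integral_inner_cellProj k v.memLp (hconst c)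
    simp only [hconst_eval] at h4
    rw [meanVec, meanVec, setAverage_eq, setAverage_eq, real_inner_smul_left, real_inner_smul_left]
    congr 1
    rw [real_inner_comm, real_inner_comm c, ← integral_inner (T.integrable_field v),
      ← integral_inner (T.integrable_evalVec _)]
    simp only [real_inner_comm _ c]
    exact h4.symm
  · rw [h3]
    have h5 : ∀ a b, ∫ x in T.carrier, v.grad x a b =
        ∑ s, ∫ x, trace T v x a * T.normal s b ∂(T.faceSurface s) := by
      intro a b
      -- With the weight `1` the mean gradient becomes a boundary integral of the trace.
      simpa using T.integral_grad_mul_add hd htr (r := fun _ => 1) contDiff_const a b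
    have h6 : ∀ s a b, ∫ x : T.face s,
        skewTensor (((reduction T k v).2 s).1 x) (T.normal s) a b ∂(faceMeasure (T.face s)) =
        2⁻¹ * ((∫ x, trace T v x a * T.normal s b ∂(T.faceSurface s)) -
          ∫ x, trace T v x b * T.normal s a ∂(T.faceSurface s)) := by
      intro s a b
      -- Chosen so that `inner ℝ y c` is the `(a, b)` entry of `y ⊗ₛₛ n`; the normal is constant on
      -- the face, so this is a test against a constant field.
      let c : Space d := (2⁻¹ * T.normal s b) • EuclideanSpace.single a 1 -
        (2⁻¹ * T.normal s a) • EuclideanSpace.single b 1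
      have hc : ∀ y : Space d, inner ℝ y c = skewTensor y (T.normal s) a b := by
        intro y
        rw [skewTensor_apply]
        simp only [c, inner_sub_right, inner_smul_right, EuclideanSpace.inner_single_right]
        simp
        ring
      have h7 := T.integral_inner_faceProj k (hgs s) (hconst c)
      simp only [hconst_eval, hc] at h7
      have hint : ∀ a b, Integrable (fun x => trace T v x a * T.normal s b) (T.faceSurface s) :=
        fun a b => (((hgs s).coord a).integrable (by norm_num)).mul_const _
      refine h7.trans ?_
      simp only [skewTensor_apply]
      rw [integral_const_mul, integral_sub (hint a b) (hint b a)]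
    ext a b
    simp only [skewPart, meanMat, Matrix.smul_apply, Matrix.sub_apply, Matrix.transpose_apply,
      Matrix.of_apply, setAverage_eq, smul_eq_mul, h5, h6]
    rw [← Finset.mul_sum, Finset.sum_sub_distrib]
    ring

end PolytopalCell

end HHO

end

theorem mainTheorem12 (d : ℕ) (hd : d = 2 ∨ d = 3) (T : HHO.PolytopalCell d)
    (k : ℕ) (hk : 1 ≤ k) :
    (∀ w : HHO.LocalSpace T k, ∃! p, HHO.IsDispRec T k w p) ∧
    (∀ v : HHO.H1 T, ∃! p, HHO.IsEllipticProj T k v p) ∧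
    HHO.dispRec T k ∘ HHO.reduction T k = HHO.ellipticProj T k := by
  have hd0 : 0 < d := by omega
  refine ⟨T.existsUnique_isDispRec k, T.existsUnique_isEllipticProj k, funext fun v => ?_⟩
  refine (T.existsUnique_isDispRec k (HHO.reduction T k v)).unique
    (Classical.epsilon_spec (T.existsUnique_isDispRec k (HHO.reduction T k v)).exists) ?_
  exact T.isDispRec_reduction hd0 k v
    (Classical.epsilon_spec (T.existsUnique_isEllipticProj k v).exists)
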